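/- Let $A_1,\dots,A_k\in\mathbb R^d$ be unit vectors, let $w_1,\dots,w_k>0$, and let $T=\sum_{i=1}^k w_i\,A_i\otimes A_i\otimes A_i$. Put $c_{\max}=\max_{i\ne j}|\langle A_i,A_j\rangle|$ (with $c_{\max}=0$ if $k\le 1$), $\gamma=\max_i w_i/\min_i w_i$ and $\eta=\max\{c_{\max},1/d\}$. Orth-ALS is the following iteration on $k$ estimates $X_1,\dots,X_k\in\mathbb R^d$, which are initialized independently and uniformly at random on the unit sphere. In each iteration the estimates are orthonormalized in the order $1,\dots,k$ by a QR decomposition (Gram–Schmidt), giving $Q_1,\dots,Q_k$, and then $X_m$ is replaced by $T(I,Q_m,Q_m)/\|T(I,Q_m,Q_m)\|$, where $T(I,x,x)=\sum_i w_i\langle A_i,x\rangle^2A_i$. The factors are started one after another: $X_m$ stays at its random initialization during the first $(m-1)N$ iterations and is updated in every later iteration, as are the estimates started before it. Let $X_{m,s}$ be the $m$-th estimate after $s$ of its own updates, and let $\hat w_{m,s}=T(X_{m,s},X_{m,s},X_{m,s})=\sum_i w_i\langle A_i,X_{m,s}\rangle^3$ be the corresponding weight estimate. **Theorem.** For all $\varepsilon>0$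 and $\Gamma>0$ there are $C>0$ and $p\in\mathbb N$, depending only on $\varepsilon$ and $\Gamma$, such that the following holds for all $d$, $k$, $A_i$, $w_i$ as above with $$\gamma\,c_{\max}\le \Gamma\,k^{-(2+\varepsilon)}\qquad\text{and}\qquad \gamma\le\Gamma d .$$ Let $\tau=C\,(1+\log k+\log(1+\log d))$ and let $N\ge\tau$ be an integer. Then, with probability at least $1-C(1+\log k)^p\,k^{-\varepsilon}$ over the random initialization, there is a permutation $\sigma$ of $\{1,\dots,k\}$ such that for every $m\in\{1,\dots,k\}$ and every integer $s\ge\tau$ $$\|A_{\sigma(m)}-X_{m,s}\|\le C\,\gamma k\eta^2\qquad\text{and}\qquad \Bigl|1-\frac{\hat w_{m,s}}{w_{\sigma(m)}}\Bigr|\le C\,\eta .$$ That is, Orth-ALS recovers all $k$ factors, each within $O(\log k+\log\log d)$ of its own iterations, with error $O(\gamma k\eta^2)$ and overall failure probability $\tilde O(k^{-\varepsilon})$. -/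

import Mathlib

open MeasureTheory

noncomputable section

/-- An order-three tensor of side length `d`. -/
abbrev Tensor3 (d : ℕ) : Type := Fin d → Fin d → Fin d → ℝ

namespace Tensor3

/-- The rank-`k` symmetric tensor `∑ i, w i • A i ⊗ A i ⊗ A i`. -/
def ofFactors {d k : ℕ} (w : Fin k → ℝ) (A : Fin k → EuclideanSpace ℝ (Fin d)) : Tensor3 d :=
  fun a b c => ∑ i, w i * A i a * A i b * A i c

/-- The contraction `T(I, x, x)`. -/
def contract {d : ℕ} (T : Tensor3 d) (x : EuclideanSpace ℝ (Fin d)) :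
    EuclideanSpace ℝ (Fin d) :=
  WithLp.toLp 2 fun a => ∑ b, ∑ c, T a b c * x b * x c

/-- The full contraction `T(x, x, x)`, which estimates the weight of the factor `x`. -/
def weightEstimate {d : ℕ} (T : Tensor3 d) (x : EuclideanSpace ℝ (Fin d)) : ℝ :=
  ∑ a, ∑ b, ∑ c, T a b c * x a * x b * x c

end Tensor3

/-- The update of the tensor power method: `T(I, x, x) / ‖T(I, x, x)‖`. -/
def powerUpdate {d : ℕ} (T : Tensor3 d) (x : EuclideanSpace ℝ (Fin d)) :
    EuclideanSpace ℝ (Fin d) :=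
  ‖T.contract x‖⁻¹ • T.contract x

/-- Orth-ALS on a tensor `T`, with initial estimates `u 0, …, u (k - 1)` and with `N` iterations
between the starts of consecutive factors. `orthALS T N u t m` is the `m`-th estimate (column `m`
of the factor matrix) after `t` iterations. Every iteration replaces the columns of the factor
matrix by their `QR` orthonormalization, in the order of the columns, and then applies the power
update to each column. Column `m` stays at its random initialization `u m` until iteration `m * N`
and is updated in every iteration from then on; the earlier columns go on being updated too. -/
def orthALS {d k : ℕ} (T : Tensor3 d) (N : ℕ) (u : Fin k → EuclideanSpace ℝ (Fin d)) :
    ℕ → Fin k → EuclideanSpace ℝ (Fin d)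
  | 0 => u
  | t + 1 => fun m =>
      if (m : ℕ) * N ≤ t then
        powerUpdate T (InnerProductSpace.gramSchmidtNormed ℝ (orthALS T N u t) m)
      else u m

/-- The incoherence `c_max = max_{i ≠ j} |⟨A i, A j⟩|` (zero if there are fewer than two
factors). -/
def incoherence {d k : ℕ} (A : Fin k → EuclideanSpace ℝ (Fin d)) : ℝ :=
  ⨆ i, ⨆ j, if i = j then 0 else |inner ℝ (A i) (A j)|

/-- The ratio `γ = w_max / w_min` of the largest and the smallest weight. -/
def weightRatio {k : ℕ} (w : Fin k → ℝ) : ℝ :=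
  (⨆ i, w i) / (⨅ i, w i)

/-- `η = max {c_max, 1 / d}`. -/
def eta {d k : ℕ} (A : Fin k → EuclideanSpace ℝ (Fin d)) : ℝ :=
  max (incoherence A) (1 / (d : ℝ))

/-- The uniform distribution on the unit sphere of `ℝ^d`: the normalized surface measure. -/
def uniformSphere (d : ℕ) : Measure (EuclideanSpace ℝ (Fin d)) :=
  ((volume : Measure (EuclideanSpace ℝ (Fin d))).toSphere Set.univ)⁻¹ •
    (volume : Measure (EuclideanSpace ℝ (Fin d))).toSphere.map Subtype.val

/-- The order of the number of iterations, `log k + log log d`, made positive for all sizes. -/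
def stepBound (k d : ℕ) : ℝ :=
  1 + Real.log k + Real.log (1 + Real.log d)

/-- All factors are recovered: up to a relabelling `σ`, each estimate is, from the `C (log k +
log log d)`-th of its own iterations on, within `C γ k η²` of its factor, and gives the weight of
that factor with relative error at most `C η`. -/
def RecoversAll {d k : ℕ} (w : Fin k → ℝ) (A : Fin k → EuclideanSpace ℝ (Fin d)) (C : ℝ) (N : ℕ)
    (u : Fin k → EuclideanSpace ℝ (Fin d)) : Prop :=
  ∃ σ : Equiv.Perm (Fin k), ∀ m : Fin k, ∀ s : ℕ, C * stepBound k d ≤ s →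
    ‖A (σ m) - orthALS (Tensor3.ofFactors w A) N u (m * N + s) m‖
        ≤ C * (weightRatio w * k * eta A ^ 2) ∧
    |1 - (Tensor3.ofFactors w A).weightEstimate
        (orthALS (Tensor3.ofFactors w A) N u (m * N + s) m) / w (σ m)| ≤ C * eta A

end

/-! Fix `β = max(c_max, d^(-K))`. Suppose the estimates before `X_m` are near distinct factors. Up
to a positive scalar, the correlations `a_j` of the factors with the orthogonalized `X_m` then
evolve by `a' = G (w a²)`, where `G` is the Gram matrix of the factors projected away from those
estimates. Its off-diagonal entries are `O(β)`, and its diagonal is at most 1 and close to 1 at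
unrecovered factors (`powerStep_corr`). So the ratios `w_j |a_j| / (w_i |a_i|)` to the leading
factor `i` are squared in each iteration, up to noise `O(kγβ)`. A relative gap `δ ≥ 32kγβ` grows
geometrically, which takes `O(log k)` iterations for `δ` of order `k^(-(1+ε))`; then the ratios
decay doubly exponentially, which takes `O(log log d)` iterations (`power_iteration_converges`). A
recovered factor cannot lead: orthogonality to its estimate pushes its weighted correlation below
half of the maximum (`NearFactor.weighted_inner_le`). Hence induction on `m` yields distinct factors
(`exists_nearFactors_of_hasGap`).

Randomness is needed only for the gap at each start. With the other initial vectors fixed, the start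
is a fixed projection of a uniform vector. Take the vectors for which `i` leads by a gap less than
`δ`, and multiply their `i`-th correlation by powers of `1/(1-δ)` while keeping the others. The
images are disjoint, lie in the cone where `i` leads, and are no smaller in volume. About `1/(δ log
k)` of them nearly fit into the ball, so the region, apart from untypically large correlations,
fills a fraction `O(δ log k)` of its cone. The cones are disjoint, so summing over `i` costs no
factor `k` (`card_mul_volume_smallGapCore_le`, `volume_noGap_le`). A union bound over the `k` starts
leaves `Õ(k^(-ε))`. -/

noncomputable section

/-! ### Nearly orthonormal families: coefficients, independence, projections. -/

section NearlyOrthonormal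

variable {E : Type*} [NormedAddCommGroup E] [InnerProductSpace ℝ E] {ι : Type*} [Fintype ι]

/-- Coefficients with respect to a nearly orthonormal family are controlled by the norm. -/
theorem sum_sq_le_two_mul_norm_sq {B : ι → E} {b : ℝ} (hB : ∀ i, ‖B i‖ = 1)
    (hb : ∀ i j, i ≠ j → |inner ℝ (B i) (B j)| ≤ b) (hb0 : 0 ≤ b)
    (hcard : (Fintype.card ι : ℝ) * b ≤ 1 / 2) (c : ι → ℝ) :
    ∑ i, c i ^ 2 ≤ 2 * ‖∑ i, c i • B i‖ ^ 2 := by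
  classical
  have h1 : ‖∑ i, c i • B i‖ ^ 2 = ∑ i, ∑ j, c i * c j * inner ℝ (B i) (B j) := by
    rw [← real_inner_self_eq_norm_sq, sum_inner]
    refine Finset.sum_congr rfl fun i _ => ?_
    rw [inner_sum]
    refine Finset.sum_congr rfl fun j _ => ?_
    rw [real_inner_smul_left, real_inner_smul_right]; ring
  -- Diagonal dominance of the Gram matrix: the squared norm is at least `(1 - card * b) ∑ c²`.
  have h2 : ∀ i j, (if i = j then c i ^ 2 else 0) - b * (|c i| * |c j|)
      ≤ c i * c j * inner ℝ (B i) (B j) := by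
    intro i j
    split_ifs with h
    · subst h
      rw [real_inner_self_eq_norm_sq, hB]
      have : 0 ≤ b * (|c i| * |c i|) := by positivity
      nlinarith
    · have h3 : |c i * c j * inner ℝ (B i) (B j)| ≤ |c i| * |c j| * b := by
        rw [abs_mul, abs_mul]
        exact mul_le_mul_of_nonneg_left (hb i j h) (by positivity)
      have := neg_abs_le (c i * c j * inner ℝ (B i) (B j))
      linarith
  have h3 : ∑ i, ∑ j, ((if i = j then c i ^ 2 else 0) - b * (|c i| * |c j|))
      = ∑ i, c i ^ 2 - b * (∑ i, |c i|) ^ 2 := by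
    simp only [Finset.sum_sub_distrib, Finset.sum_ite_eq, Finset.mem_univ, if_true]
    rw [sq (∑ i, |c i|), Finset.sum_mul_sum, Finset.mul_sum]
    simp only [Finset.mul_sum]
  have h4 : (∑ i, |c i|) ^ 2 ≤ Fintype.card ι * ∑ i, c i ^ 2 := by
    have := sq_sum_le_card_mul_sum_sq (s := (Finset.univ : Finset ι)) (f := fun i => |c i|)
    simpa [sq_abs] using this
  have h5 : ∑ i, c i ^ 2 - b * (∑ i, |c i|) ^ 2 ≤ ‖∑ i, c i • B i‖ ^ 2 := by
    rw [h1, ← h3]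
    exact Finset.sum_le_sum fun i _ => Finset.sum_le_sum fun j _ => h2 i j
  have h6 : 0 ≤ ∑ i, c i ^ 2 := Finset.sum_nonneg fun i _ => sq_nonneg _
  nlinarith [mul_le_mul_of_nonneg_left h4 hb0]

/-- A nearly orthonormal family is linearly independent. -/
theorem linearIndependent_of_nearly_orthonormal {B : ι → E} {b : ℝ} (hB : ∀ i, ‖B i‖ = 1)
    (hb : ∀ i j, i ≠ j → |inner ℝ (B i) (B j)| ≤ b) (hb0 : 0 ≤ b)
    (hcard : (Fintype.card ι : ℝ) * b ≤ 1 / 2) : LinearIndependent ℝ B := by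
  rw [Fintype.linearIndependent_iff]
  intro c hc i
  have h := sum_sq_le_two_mul_norm_sq hB hb hb0 hcard c
  rw [hc] at h
  have h1 : c i ^ 2 ≤ ∑ i, c i ^ 2 :=
    Finset.single_le_sum (f := fun i => c i ^ 2) (fun i _ => sq_nonneg _) (Finset.mem_univ i)
  simp at h
  have : c i ^ 2 = 0 := le_antisymm (h1.trans h) (sq_nonneg _)
  simpa using this

/-- The projection of a vector onto the span of a nearly orthonormal family is short if the vector
is nearly orthogonal to the family. -/
theorem norm_sq_proj_le {B : ι → E} {b : ℝ} (hB : ∀ i, ‖B i‖ = 1)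
    (hb : ∀ i j, i ≠ j → |inner ℝ (B i) (B j)| ≤ b) (hb0 : 0 ≤ b)
    (hcard : (Fintype.card ι : ℝ) * b ≤ 1 / 2) {v : E} (hv : ∀ i, |inner ℝ v (B i)| ≤ b)
    [(Submodule.span ℝ (Set.range B)).HasOrthogonalProjection] :
    ‖(Submodule.span ℝ (Set.range B)).starProjection v‖ ^ 2 ≤ 2 * Fintype.card ι * b ^ 2 := by
  set V := Submodule.span ℝ (Set.range B)
  set p := V.starProjection v with hp
  have hpV : p ∈ V := Submodule.starProjection_apply_mem V v
  obtain ⟨c, hc⟩ := (Submodule.mem_span_range_iff_exists_fun ℝ).1 hpV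
  -- With `p = ∑ c_i B_i`, one has `‖p‖² = ⟨v, p⟩ ≤ b ∑ |c_i|`, which is at most `b` times the
  -- square root of `2 card ‖p‖²`; then `‖p‖²` cancels.
  have h1 : ‖p‖ ^ 2 = inner ℝ v p := by
    have := Submodule.starProjection_inner_eq_zero (K := V) v p hpV
    rw [inner_sub_left, sub_eq_zero] at this
    rw [this, real_inner_self_eq_norm_sq]
  have h2 : inner ℝ v p ≤ b * ∑ i, |c i| := by
    rw [← hc, inner_sum, Finset.mul_sum]
    refine Finset.sum_le_sum fun i _ => ?_
    rw [real_inner_smul_right]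
    calc c i * inner ℝ v (B i) ≤ |c i * inner ℝ v (B i)| := le_abs_self _
      _ ≤ |c i| * b := by rw [abs_mul]; exact mul_le_mul_of_nonneg_left (hv i) (abs_nonneg _)
      _ = b * |c i| := mul_comm _ _
  have h4 : (∑ i, |c i|) ^ 2 ≤ Fintype.card ι * ∑ i, c i ^ 2 := by
    have := sq_sum_le_card_mul_sum_sq (s := (Finset.univ : Finset ι)) (f := fun i => |c i|)
    simpa [sq_abs] using this
  have h5 := sum_sq_le_two_mul_norm_sq hB hb hb0 hcard c
  rw [hc] at h5
  have h6 : (‖p‖ ^ 2) ^ 2 ≤ (2 * Fintype.card ι * b ^ 2) * ‖p‖ ^ 2 := by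
    have h7 : (‖p‖ ^ 2) ^ 2 ≤ (b * ∑ i, |c i|) ^ 2 :=
      pow_le_pow_left₀ (by positivity) (h1.le.trans h2) 2
    have h8 : (Fintype.card ι : ℝ) * ∑ i, c i ^ 2 ≤ Fintype.card ι * (2 * ‖p‖ ^ 2) :=
      mul_le_mul_of_nonneg_left h5 (by positivity)
    calc (‖p‖ ^ 2) ^ 2 ≤ b ^ 2 * (∑ i, |c i|) ^ 2 := by rw [← mul_pow]; exact h7
      _ ≤ b ^ 2 * (Fintype.card ι * (2 * ‖p‖ ^ 2)) :=
        mul_le_mul_of_nonneg_left (h4.trans h8) (by positivity)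
      _ = _ := by ring
  rcases eq_or_lt_of_le (sq_nonneg ‖p‖) with h | h
  · rw [← h]; positivity
  · rw [sq (‖p‖ ^ 2)] at h6
    exact le_of_mul_le_mul_right h6 h

end NearlyOrthonormal

/-! ### Estimates near factors, and the factors projected away from them. -/

section Regular

/-- Unit factors with coherence at most `β` and weight ratio at most `γ`, where `β` is small. -/
structure Regular {d k : ℕ} (w : Fin k → ℝ) (A : Fin k → EuclideanSpace ℝ (Fin d)) (γ β : ℝ) :
    Prop where
  norm_eq : ∀ i, ‖A i‖ = 1
  pos : ∀ i, 0 < w i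
  ratio : ∀ i j, w i ≤ γ * w j
  coh : ∀ i j, i ≠ j → |inner ℝ (A i) (A j)| ≤ β
  one_le : 1 ≤ γ
  card_pos : 1 ≤ k
  beta_pos : 0 < β
  -- The second factor `k` makes the noise `n = 2kγβ` satisfy `3n ≤ 1/k`, which the last phase of
  -- `power_iteration_converges` needs.
  small : (k : ℝ) ^ 2 * γ * β ≤ 1 / 100000

/-- `X` is the normalization of `T(I, q, q)` for some `q` that is nearly orthogonal to all factors
except the `i`-th one. -/
def NearFactor {d k : ℕ} (w : Fin k → ℝ) (A : Fin k → EuclideanSpace ℝ (Fin d)) (β : ℝ)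
    (i : Fin k) (X : EuclideanSpace ℝ (Fin d)) : Prop :=
  ‖X‖ = 1 ∧ ∃ θ : ℝ, 0 < θ ∧ ∃ ρ : Fin k → ℝ, ρ i = 1 ∧ (∀ j, j ≠ i → |ρ j| ≤ 9 * β) ∧
    θ • X = ∑ j, (w j * ρ j ^ 2) • A j

variable {d k : ℕ} {w : Fin k → ℝ} {A : Fin k → EuclideanSpace ℝ (Fin d)} {γ β : ℝ}

namespace Regular

theorem small' (h : Regular w A γ β) : (k : ℝ) * γ * β ≤ 1 / 100000 / k := by
  have hk : (0 : ℝ) < k := by exact_mod_cast h.card_pos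
  rw [le_div_iff₀ hk]
  nlinarith [h.small]

theorem one_le_card (h : Regular w A γ β) : (1 : ℝ) ≤ k := by exact_mod_cast h.card_pos

theorem card_mul_ratio_mul_le (h : Regular w A γ β) : (k : ℝ) * γ * β ≤ 1 / 100000 := by
  have hk := h.one_le_card
  refine h.small'.trans (div_le_self (by norm_num) hk)

theorem card_mul_le (h : Regular w A γ β) : (k : ℝ) * β ≤ 1 / 100000 := by
  have hk := h.one_le_card
  have h1 := h.card_mul_ratio_mul_le
  have : 0 ≤ (k : ℝ) * β * (γ - 1) :=
    mul_nonneg (mul_nonneg (by linarith) h.beta_pos.le) (by linarith [h.one_le])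
  linarith [this, h1]

theorem beta_le (h : Regular w A γ β) : β ≤ 1 / 100000 := by
  nlinarith [h.card_mul_le, h.one_le_card, h.beta_pos]

end Regular

namespace NearFactor

/-- A vector near a factor is a positive multiple of a small perturbation of that factor. -/
theorem exists_error {i : Fin k} {X : EuclideanSpace ℝ (Fin d)} (hX : NearFactor w A β i X)
    (h : Regular w A γ β) :
    ∃ e : EuclideanSpace ℝ (Fin d), ∃ θ : ℝ, 0 < θ ∧ ‖e‖ ≤ 81 * (k * γ * β ^ 2) ∧
      θ • X = A i + e := by
  obtain ⟨-, θ, hθ, ρ, hρi, hρ, hs⟩ := hX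
  have hwi := h.pos i
  refine ⟨∑ j ∈ Finset.univ.erase i, (w j / w i * ρ j ^ 2) • A j, θ / w i, by positivity, ?_, ?_⟩
  · have h1 : ∀ j ∈ Finset.univ.erase i, ‖(w j / w i * ρ j ^ 2) • A j‖ ≤ 81 * (γ * β ^ 2) := by
      intro j hj
      have hj' := Finset.ne_of_mem_erase hj
      have hwj := h.pos j
      rw [norm_smul, h.norm_eq, mul_one, Real.norm_eq_abs, abs_of_nonneg (by positivity)]
      have h2 : w j / w i ≤ γ := by rw [div_le_iff₀ hwi]; exact h.ratio j i
      have h3 : ρ j ^ 2 ≤ (9 * β) ^ 2 := sq_le_sq' (by linarith [neg_abs_le (ρ j), hρ j hj'])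
        ((le_abs_self _).trans (hρ j hj'))
      calc w j / w i * ρ j ^ 2 ≤ γ * (9 * β) ^ 2 :=
            mul_le_mul h2 h3 (sq_nonneg _) (by linarith [h.one_le])
        _ = _ := by ring
    refine (norm_sum_le_of_le _ h1).trans ?_
    rw [Finset.sum_const, nsmul_eq_mul]
    have h4 : ((Finset.univ.erase i).card : ℝ) ≤ k := by
      have := Finset.card_le_univ (Finset.univ.erase i)
      rw [Fintype.card_fin] at this
      exact_mod_cast this
    have h5 : 0 ≤ 81 * (γ * β ^ 2) := by have := h.one_le; positivity
    nlinarith [mul_le_mul_of_nonneg_right h4 h5]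
  · rw [div_eq_inv_mul, mul_smul, hs, Finset.smul_sum,
      ← Finset.add_sum_erase _ _ (Finset.mem_univ i), hρi]
    congr 1
    · rw [smul_smul]; simp [hwi.ne']
    · refine Finset.sum_congr rfl fun j _ => ?_
      rw [smul_smul]; congr 1; ring

/-- The perturbation and the renormalization each cost at most `‖e‖`, whence `162 = 2 * 81`. -/
theorem norm_sub_le {i : Fin k} {X : EuclideanSpace ℝ (Fin d)} (hX : NearFactor w A β i X)
    (h : Regular w A γ β) : ‖A i - X‖ ≤ 162 * (k * γ * β ^ 2) := by
  obtain ⟨e, θ, hθ, he, hs⟩ := hX.exists_error h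
  have hX1 := hX.1
  have h1 : |θ - 1| ≤ ‖e‖ := by
    have h2 : ‖θ • X‖ = θ := by rw [norm_smul, hX1, mul_one, Real.norm_eq_abs, abs_of_pos hθ]
    have h3 := abs_norm_sub_norm_le (θ • X) (A i)
    rw [h2, h.norm_eq, hs] at h3
    simpa using h3
  have h4 : A i - X = (θ - 1) • X - e := by rw [sub_smul, one_smul, hs]; abel
  rw [h4]
  refine (_root_.norm_sub_le _ _).trans ?_
  rw [norm_smul, hX1, Real.norm_eq_abs]
  linarith

/-- A vector orthogonal to `X` has a small correlation with the factor near `X`. -/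
theorem weighted_inner_le {i : Fin k} {X : EuclideanSpace ℝ (Fin d)} (hX : NearFactor w A β i X)
    (h : Regular w A γ β) {q : EuclideanSpace ℝ (Fin d)} (hq : inner ℝ X q = 0) {M : ℝ}
    (hM : ∀ j, w j * |inner ℝ (A j) q| ≤ M) :
    w i * |inner ℝ (A i) q| ≤ M / 2 := by
  -- The expansion of `X` carries the weights `w j` themselves, so each term of `⟨X, q⟩ = 0` is
  -- comparable with `M`. A bound on `‖A i - X‖` alone would bring in `‖q‖`, which `M` does not
  -- control.
  obtain ⟨-, θ, hθ, ρ, hρi, hρ, hs⟩ := hX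
  have h1 : ∑ j, w j * ρ j ^ 2 * inner ℝ (A j) q = 0 := by
    have : inner ℝ (θ • X) q = 0 := by rw [real_inner_smul_left, hq, mul_zero]
    rw [hs, sum_inner] at this
    simpa [real_inner_smul_left] using this
  rw [← Finset.add_sum_erase _ _ (Finset.mem_univ i), hρi] at h1
  have h2 : w i * |inner ℝ (A i) q| = |∑ j ∈ Finset.univ.erase i, w j * ρ j ^ 2 * inner ℝ (A j) q| := by
    have h3 : w i * inner ℝ (A i) q
        = -∑ j ∈ Finset.univ.erase i, w j * ρ j ^ 2 * inner ℝ (A j) q := by linarith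
    rw [← abs_neg (∑ j ∈ Finset.univ.erase i, _), ← h3, abs_mul, abs_of_pos (h.pos i)]
  have hM0 : 0 ≤ M := (mul_nonneg (h.pos i).le (abs_nonneg _)).trans (hM i)
  have h3 : ∀ j ∈ Finset.univ.erase i, |w j * ρ j ^ 2 * inner ℝ (A j) q| ≤ 81 * β ^ 2 * M := by
    intro j hj
    have hj' := Finset.ne_of_mem_erase hj
    have h3 : ρ j ^ 2 ≤ (9 * β) ^ 2 := sq_le_sq' (by linarith [neg_abs_le (ρ j), hρ j hj'])
        ((le_abs_self _).trans (hρ j hj'))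
    have hwj := h.pos j
    rw [abs_mul, abs_mul, abs_of_pos hwj, abs_of_nonneg (sq_nonneg _)]
    calc w j * ρ j ^ 2 * |inner ℝ (A j) q| = ρ j ^ 2 * (w j * |inner ℝ (A j) q|) := by ring
      _ ≤ (9 * β) ^ 2 * M := mul_le_mul h3 (hM j) (by positivity) (by positivity)
      _ = _ := by ring
  rw [h2]
  refine (Finset.abs_sum_le_sum_abs _ _).trans ((Finset.sum_le_sum h3).trans ?_)
  rw [Finset.sum_const, nsmul_eq_mul]
  have h4 : ((Finset.univ.erase i).card : ℝ) ≤ k := by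
    have := Finset.card_le_univ (Finset.univ.erase i)
    rw [Fintype.card_fin] at this
    exact_mod_cast this
  have h5 : (k : ℝ) * (81 * β ^ 2) ≤ 1 / 2 := by
    have := h.card_mul_le
    have := h.beta_le
    nlinarith [h.beta_pos, h.one_le_card]
  calc _ ≤ (k : ℝ) * (81 * β ^ 2 * M) := mul_le_mul_of_nonneg_right h4 (by positivity)
    _ = (k : ℝ) * (81 * β ^ 2) * M := by ring
    _ ≤ 1 / 2 * M := mul_le_mul_of_nonneg_right h5 hM0
    _ = _ := by ring

end NearFactor

/-- Estimates near distinct factors. -/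
structure NearFactors {d k : ℕ} (w : Fin k → ℝ) (A : Fin k → EuclideanSpace ℝ (Fin d)) (β : ℝ)
    {ι : Type*} (σ : ι → Fin k) (X : ι → EuclideanSpace ℝ (Fin d)) : Prop where
  near : ∀ l, NearFactor w A β (σ l) (X l)
  inj : Function.Injective σ

namespace NearFactors

variable {ι : Type*} {σ : ι → Fin k} {X : ι → EuclideanSpace ℝ (Fin d)}

theorem error_le (h : Regular w A γ β) : 162 * (k * γ * β ^ 2) ≤ β / 100 := by
  have := h.card_mul_ratio_mul_le
  nlinarith [h.beta_pos]

theorem abs_inner_factor_le (hX : NearFactors w A β σ X) (h : Regular w A γ β) {i : Fin k} {l : ι}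
    (hi : i ≠ σ l) : |inner ℝ (A i) (X l)| ≤ 2 * β := by
  have h1 := (hX.near l).norm_sub_le h
  have h2 : inner ℝ (A i) (X l) = inner ℝ (A i) (A (σ l)) - inner ℝ (A i) (A (σ l) - X l) := by
    rw [inner_sub_right]; ring
  have h3 := abs_real_inner_le_norm (A i) (A (σ l) - X l)
  rw [h.norm_eq, one_mul] at h3
  rw [h2]
  refine (abs_sub _ _).trans ?_
  have := error_le h
  linarith [h.coh _ _ hi, h.beta_pos]

theorem abs_inner_le (hX : NearFactors w A β σ X) (h : Regular w A γ β) {l l' : ι}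
    (hl : l ≠ l') : |inner ℝ (X l) (X l')| ≤ 2 * β := by
  have h1 := (hX.near l).norm_sub_le h
  have h1' := (hX.near l').norm_sub_le h
  have hne : σ l ≠ σ l' := fun e => hl (hX.inj e)
  have h2 : inner ℝ (X l) (X l') = inner ℝ (A (σ l)) (A (σ l'))
      - inner ℝ (A (σ l)) (A (σ l') - X l') - inner ℝ (A (σ l) - X l) (X l') := by
    simp only [inner_sub_right, inner_sub_left]; ring
  have h3 := abs_real_inner_le_norm (A (σ l)) (A (σ l') - X l')
  have h4 := abs_real_inner_le_norm (A (σ l) - X l) (X l')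
  rw [h.norm_eq, one_mul] at h3
  rw [(hX.near l').1, mul_one] at h4
  rw [h2]
  refine (abs_sub _ _).trans ?_
  have h5 := abs_sub (inner ℝ (A (σ l)) (A (σ l'))) (inner ℝ (A (σ l)) (A (σ l') - X l'))
  have := error_le h
  linarith [h.coh _ _ hne, h.beta_pos]

theorem card_le [Fintype ι] (hX : NearFactors w A β σ X) : (Fintype.card ι : ℝ) ≤ k := by
  have := Fintype.card_le_of_injective σ hX.inj
  rw [Fintype.card_fin] at this
  exact_mod_cast this

theorem card_mul_le [Fintype ι] (hX : NearFactors w A β σ X) (h : Regular w A γ β) :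
    (Fintype.card ι : ℝ) * (2 * β) ≤ 1 / 2 := by
  have h1 := hX.card_le
  have := mul_le_mul_of_nonneg_right h1 (by linarith [h.beta_pos] : 0 ≤ 2 * β)
  linarith [h.card_mul_le]

/-- A factor that is not near any of the estimates is nearly orthogonal to their span. -/
theorem norm_sq_proj_factor_le [Fintype ι] (hX : NearFactors w A β σ X) (h : Regular w A γ β) {i : Fin k}
    (hi : ∀ l, i ≠ σ l) :
    ‖(Submodule.span ℝ (Set.range X)).starProjection (A i)‖ ^ 2 ≤ β := by
  have h1 := norm_sq_proj_le (fun l => (hX.near l).1) (fun l l' => hX.abs_inner_le h)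
    (by linarith [h.beta_pos]) (hX.card_mul_le h) (fun l => hX.abs_inner_factor_le h (hi l))
  refine h1.trans ?_
  have := hX.card_le
  have := h.card_mul_le
  have h2 : (Fintype.card ι : ℝ) * β ≤ 1 / 100000 :=
    (mul_le_mul_of_nonneg_right hX.card_le h.beta_pos.le).trans h.card_mul_le
  nlinarith [h.beta_pos]

/-- The projection kills `X l`, a multiple of `A (σ l) + e`, so only the second-order error `e`
survives. -/
theorem norm_residual_le (hX : NearFactors w A β σ X) (h : Regular w A γ β) (l : ι) :
    ‖(Submodule.span ℝ (Set.range X))ᗮ.starProjection (A (σ l))‖ ≤ β := by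
  obtain ⟨e, θ, -, he, hs⟩ := (hX.near l).exists_error h
  set V := Submodule.span ℝ (Set.range X)
  have h0 : Vᗮ.starProjection (θ • X l) = 0 := by
    apply Submodule.starProjection_orthogonal_apply_eq_zero
    exact Submodule.smul_mem _ _ (Submodule.subset_span ⟨l, rfl⟩)
  rw [hs, map_add] at h0
  have h1 : Vᗮ.starProjection (A (σ l)) = - Vᗮ.starProjection e := eq_neg_of_add_eq_zero_left h0
  rw [h1, norm_neg]
  have := Submodule.norm_starProjection_apply_le Vᗮ e
  have := error_le h
  linarith [h.beta_pos]

/-- The Gram matrix of the factors, projected to the orthogonal complement of the estimates. -/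
def gram (A : Fin k → EuclideanSpace ℝ (Fin d)) (X : ι → EuclideanSpace ℝ (Fin d))
    (i j : Fin k) : ℝ :=
  inner ℝ (A i) ((Submodule.span ℝ (Set.range X))ᗮ.starProjection (A j))

theorem gram_self (i : Fin k) :
    gram A X i i = ‖(Submodule.span ℝ (Set.range X))ᗮ.starProjection (A i)‖ ^ 2 := by
  set P := (Submodule.span ℝ (Set.range X))ᗮ
  have h1 : P.starProjection (P.starProjection (A i)) = P.starProjection (A i) :=
    Submodule.starProjection_eq_self_iff.2 (Submodule.starProjection_apply_mem _ _)
  rw [gram, ← h1, ← Submodule.inner_starProjection_left_eq_right, real_inner_self_eq_norm_sq, h1]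

theorem gram_self_nonneg (i : Fin k) : 0 ≤ gram A X i i := by rw [gram_self]; positivity

theorem gram_self_le (h : Regular w A γ β) (i : Fin k) : gram A X i i ≤ 1 := by
  rw [gram_self]
  have := Submodule.norm_starProjection_apply_le (Submodule.span ℝ (Set.range X))ᗮ (A i)
  rw [h.norm_eq] at this
  exact pow_le_one₀ (norm_nonneg _) this

theorem le_gram_self [Fintype ι] (hX : NearFactors w A β σ X) (h : Regular w A γ β) {i : Fin k}
    (hi : ∀ l, i ≠ σ l) : 1 - 2 * β ≤ gram A X i i := by
  rw [gram_self]
  have h1 := hX.norm_sq_proj_factor_le h hi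
  have h2 := Submodule.norm_sq_eq_add_norm_sq_starProjection (A i) (Submodule.span ℝ (Set.range X))
  rw [h.norm_eq] at h2
  linarith [h.beta_pos]

theorem abs_gram_le [Fintype ι] (hX : NearFactors w A β σ X) (h : Regular w A γ β) {i j : Fin k}
    (hij : i ≠ j) : |gram A X i j| ≤ 2 * β := by
  have hβ := h.beta_pos
  set V := Submodule.span ℝ (Set.range X) with hV
  -- If either factor is recovered, its residual alone is short enough.
  by_cases hj : ∃ l, j = σ l
  · obtain ⟨l, rfl⟩ := hj
    have h1 := hX.norm_residual_le h l
    have h2 := abs_real_inner_le_norm (A i) (Vᗮ.starProjection (A (σ l)))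
    rw [h.norm_eq, one_mul] at h2
    exact h2.trans (by linarith)
  by_cases hi : ∃ l, i = σ l
  · obtain ⟨l, rfl⟩ := hi
    have h1 := hX.norm_residual_le h l
    have h2 := abs_real_inner_le_norm (Vᗮ.starProjection (A (σ l))) (A j)
    rw [h.norm_eq, mul_one, Submodule.inner_starProjection_left_eq_right] at h2
    exact h2.trans (by linarith)
  push Not at hi hj
  have h1 := hX.norm_sq_proj_factor_le h hi
  have h2 := hX.norm_sq_proj_factor_le h hj
  -- Both factors are unrecovered: the entry is the original inner product minus that of the
  -- projections to the span, whose squared norms are at most `β`.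
  have h3 : gram A X i j = inner ℝ (A i) (A j)
      - inner ℝ (V.starProjection (A i)) (V.starProjection (A j)) := by
    have h4 : V.starProjection (V.starProjection (A j)) = V.starProjection (A j) :=
      Submodule.starProjection_eq_self_iff.2 (Submodule.starProjection_apply_mem _ _)
    change inner ℝ (A i) (Vᗮ.starProjection (A j)) = _
    rw [Submodule.inner_starProjection_left_eq_right, h4, ← inner_sub_right,
      Submodule.starProjection_orthogonal_val]
  have h5 := abs_real_inner_le_norm (V.starProjection (A i)) (V.starProjection (A j))
  rw [h3]
  refine (abs_sub _ _).trans ?_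
  have := h.coh i j hij
  nlinarith [sq_nonneg (‖V.starProjection (A i)‖ - ‖V.starProjection (A j)‖)]

end NearFactors

end Regular

/-! ### Deterministic dynamics of the weighted correlations. -/

section PowerDynamics

variable {k : ℕ}

/-- One step of the power iteration on the correlations `a` with the factors: `a'` is the image of
`w a²` under a matrix close to the identity. -/
def PowerStep (w : Fin k → ℝ) (b : ℝ) (i : Fin k) (a a' : Fin k → ℝ) : Prop :=
  ∃ c : ℝ, 0 < c ∧ ∃ G : Fin k → Fin k → ℝ, (∀ j l, j ≠ l → |G j l| ≤ b) ∧
    (∀ j, 0 ≤ G j j ∧ G j j ≤ 1) ∧ 1 - b ≤ G i i ∧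
    ∀ j, a' j = c * ∑ l, w l * a l ^ 2 * G j l

/-- The weighted correlation with factor `j` relative to that with factor `i`. -/
def relCorr (w a : Fin k → ℝ) (i j : Fin k) : ℝ := w j * |a j| / (w i * |a i|)

variable {w a a' : Fin k → ℝ} {i : Fin k} {b : ℝ}

theorem relCorr_nonneg (hw : ∀ j, 0 < w j) (j : Fin k) : 0 ≤ relCorr w a i j := by
  have := hw i; have := hw j; unfold relCorr; positivity

theorem relCorr_self (hw : ∀ j, 0 < w j) (hai : a i ≠ 0) : relCorr w a i i = 1 := by
  have := hw i
  have := abs_pos.2 hai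
  unfold relCorr
  field_simp

namespace PowerStep

/-- Off-diagonal entries contribute at most `b` times the total energy `∑ w a²`. Coordinate `i`
loses this amount twice, the second time through `1 - b ≤ G i i`. -/
theorem abs_mul_le (hs : PowerStep w b i a a') (hw : ∀ j, 0 < w j) (hb : 0 ≤ b)
    (hH : 2 * b * ∑ l, w l * a l ^ 2 < w i * a i ^ 2) :
    a' i ≠ 0 ∧ ∀ j, |a' j| * (w i * a i ^ 2 - 2 * b * ∑ l, w l * a l ^ 2)
      ≤ |a' i| * (w j * a j ^ 2 + b * ∑ l, w l * a l ^ 2) := by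
  obtain ⟨c, hc, G, hG, hG1, hGi, ha'⟩ := hs
  set H := ∑ l, w l * a l ^ 2
  have hterm : ∀ l, 0 ≤ w l * a l ^ 2 := fun l => mul_nonneg (hw l).le (sq_nonneg _)
  have hnoise : ∀ j, |∑ l ∈ Finset.univ.erase j, w l * a l ^ 2 * G j l| ≤ b * H := by
    intro j
    refine (Finset.abs_sum_le_sum_abs _ _).trans ?_
    calc ∑ l ∈ Finset.univ.erase j, |w l * a l ^ 2 * G j l|
        ≤ ∑ l ∈ Finset.univ.erase j, b * (w l * a l ^ 2) := by
          refine Finset.sum_le_sum fun l hl => ?_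
          rw [abs_mul, abs_of_nonneg (hterm l), mul_comm b]
          exact mul_le_mul_of_nonneg_left (hG j l (Finset.ne_of_mem_erase hl).symm) (hterm l)
      _ ≤ ∑ l, b * (w l * a l ^ 2) :=
          Finset.sum_le_sum_of_subset_of_nonneg (Finset.erase_subset _ _)
            fun l _ _ => mul_nonneg hb (hterm l)
      _ = b * H := by rw [Finset.mul_sum]
  have hdec : ∀ j, a' j = c * (w j * a j ^ 2 * G j j
      + ∑ l ∈ Finset.univ.erase j, w l * a l ^ 2 * G j l) := by
    intro j; rw [ha', Finset.add_sum_erase _ (fun l => w l * a l ^ 2 * G j l) (Finset.mem_univ j)]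
  have hiH : w i * a i ^ 2 ≤ H :=
    Finset.single_le_sum (f := fun l => w l * a l ^ 2) (fun l _ => hterm l) (Finset.mem_univ i)
  have hlow : c * (w i * a i ^ 2 - 2 * b * H) ≤ a' i := by
    rw [hdec i]
    refine mul_le_mul_of_nonneg_left ?_ hc.le
    have h1 := (abs_le.1 (hnoise i)).1
    have h2 : w i * a i ^ 2 * (1 - b) ≤ w i * a i ^ 2 * G i i :=
      mul_le_mul_of_nonneg_left hGi (hterm i)
    nlinarith [mul_le_mul_of_nonneg_left hiH hb]
  have hpos : 0 < a' i := lt_of_lt_of_le (mul_pos hc (by linarith)) hlow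
  refine ⟨hpos.ne', fun j => ?_⟩
  have hup : |a' j| ≤ c * (w j * a j ^ 2 + b * H) := by
    rw [hdec j, abs_mul, abs_of_pos hc]
    refine mul_le_mul_of_nonneg_left ((abs_add_le _ _).trans (add_le_add ?_ (hnoise j))) hc.le
    rw [abs_of_nonneg (mul_nonneg (hterm j) (hG1 j).1)]
    exact mul_le_of_le_one_right (hterm j) (hG1 j).2
  have hbH : 0 ≤ w j * a j ^ 2 + b * H :=
    add_nonneg (hterm j) (mul_nonneg hb (Finset.sum_nonneg fun l _ => hterm l))
  rw [abs_of_pos hpos]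
  calc |a' j| * (w i * a i ^ 2 - 2 * b * H)
      ≤ c * (w j * a j ^ 2 + b * H) * (w i * a i ^ 2 - 2 * b * H) :=
        mul_le_mul_of_nonneg_right hup (by linarith)
    _ = c * (w i * a i ^ 2 - 2 * b * H) * (w j * a j ^ 2 + b * H) := by ring
    _ ≤ _ := mul_le_mul_of_nonneg_right hlow hbH

/-- Division of `abs_mul_le` by `w i * a i ^ 2`; `h` is the total energy relative to that of factor
`i`. It stays a parameter because it is bounded by `kγ` at first and by 2 later. -/
theorem relCorr_mul_le (hs : PowerStep w b i a a') (hw : ∀ j, 0 < w j) (hb : 0 ≤ b)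
    (hai : a i ≠ 0) {h : ℝ} (hh : ∑ l, w i / w l * relCorr w a i l ^ 2 = h)
    (hbh : 2 * b * h < 1) :
    a' i ≠ 0 ∧ ∀ j, relCorr w a' i j * (1 - 2 * b * h)
      ≤ relCorr w a i j ^ 2 + w j / w i * (b * h) := by
  have hwi := hw i
  have hai' : 0 < |a i| := abs_pos.2 hai
  have hsq : 0 < w i * a i ^ 2 := by positivity
  have hH : ∑ l, w l * a l ^ 2 = w i * a i ^ 2 * h := by
    rw [← hh, Finset.mul_sum]
    refine Finset.sum_congr rfl fun l _ => ?_
    have := hw l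
    unfold relCorr
    rw [div_pow, mul_pow, mul_pow, sq_abs, sq_abs]
    field_simp
  obtain ⟨h1, h2⟩ := hs.abs_mul_le hw hb (by
    rw [hH]; nlinarith)
  refine ⟨h1, fun j => ?_⟩
  have hwj := hw j
  have h1' : 0 < |a' i| := abs_pos.2 h1
  have h3 := h2 j
  rw [hH] at h3
  have h4 : relCorr w a i j ^ 2 = w j / w i * (w j * a j ^ 2 / (w i * a i ^ 2)) := by
    unfold relCorr
    rw [div_pow, mul_pow, mul_pow, sq_abs, sq_abs]
    field_simp
  have h5 : relCorr w a' i j = w j / w i * (|a' j| / |a' i|) := by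
    unfold relCorr; field_simp
  rw [h4, h5, mul_assoc, ← mul_add]
  refine mul_le_mul_of_nonneg_left ?_ (by positivity)
  rw [div_mul_eq_mul_div, div_le_iff₀ h1']
  have h6 : (w j * a j ^ 2 / (w i * a i ^ 2) + b * h) * |a' i|
      = |a' i| * (w j * a j ^ 2 + b * (w i * a i ^ 2 * h)) / (w i * a i ^ 2) := by
    field_simp
  rw [h6, le_div_iff₀ hsq]
  calc _ = |a' j| * (w i * a i ^ 2 - 2 * b * (w i * a i ^ 2 * h)) := by ring
    _ ≤ _ := h3

/-- The effect of a power step when factor `i` dominates. -/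
theorem relCorr_le_of_le_one (hs : PowerStep w b i a a') (hw : ∀ j, 0 < w j) (hb : 0 ≤ b)
    (hai : a i ≠ 0) {γ : ℝ} (hγ : ∀ j l, w j ≤ γ * w l) (hγ0 : 0 ≤ γ)
    (hsmall : b * (k * γ) ≤ 1 / 100)
    (hr : ∀ j, relCorr w a i j ≤ 1) :
    a' i ≠ 0 ∧ ∀ j, relCorr w a' i j * (1 - 2 * (b * (k * γ)))
      ≤ relCorr w a i j ^ 2 + min 1 (w j / w i) * (b * (k * γ)) := by
  have hbound : ∀ j, ∑ l, w j / w l * relCorr w a i l ^ 2 ≤ k * γ := by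
    intro j
    calc ∑ l, w j / w l * relCorr w a i l ^ 2 ≤ ∑ _l : Fin k, γ := by
          refine Finset.sum_le_sum fun l _ => ?_
          have h1 : w j / w l ≤ γ := by rw [div_le_iff₀ (hw l)]; exact hγ j l
          have h2 : relCorr w a i l ^ 2 ≤ 1 := pow_le_one₀ (relCorr_nonneg hw l) (hr l)
          calc _ ≤ γ * 1 := mul_le_mul h1 h2 (sq_nonneg _) hγ0
            _ = γ := mul_one γ
      _ = k * γ := by simp
  set h := ∑ l, w i / w l * relCorr w a i l ^ 2 with hh
  have hh1 : h ≤ k * γ := hbound i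
  have hbh : b * h ≤ b * (k * γ) := mul_le_mul_of_nonneg_left hh1 hb
  obtain ⟨h1, h2⟩ := hs.relCorr_mul_le hw hb hai hh.symm (by linarith)
  refine ⟨h1, fun j => ?_⟩
  -- The prefactor either stays outside or is absorbed into the sum, where it turns `w i / w l` into
  -- `w j / w l`; both sums are at most `kγ`.
  have h3 : w j / w i * (b * h) ≤ min 1 (w j / w i) * (b * (k * γ)) := by
    have hpos : 0 ≤ b * (k * γ) := by positivity
    rcases min_cases 1 (w j / w i) with ⟨e, _⟩ | ⟨e, _⟩
    · rw [e, one_mul]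
      have h4 : w j / w i * h = ∑ l, w j / w l * relCorr w a i l ^ 2 := by
        rw [hh, Finset.mul_sum]
        refine Finset.sum_congr rfl fun l _ => ?_
        have := hw i; have := hw l
        field_simp
      calc _ = b * (w j / w i * h) := by ring
        _ ≤ _ := mul_le_mul_of_nonneg_left (h4 ▸ hbound j) hb
    · rw [e]
      exact mul_le_mul_of_nonneg_left hbh (div_nonneg (hw j).le (hw i).le)
  calc _ ≤ relCorr w a' i j * (1 - 2 * b * h) :=
        mul_le_mul_of_nonneg_left (by linarith) (relCorr_nonneg hw j)
    _ ≤ _ := h2 j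
    _ ≤ _ := by linarith

/-- The effect of a power step when factor `i` dominates strongly. -/
theorem relCorr_le_of_le_inv (hs : PowerStep w b i a a') (hw : ∀ j, 0 < w j) (hb : 0 ≤ b)
    (hai : a i ≠ 0) (hsmall : b ≤ 1 / 100)
    (hr : ∀ j, j ≠ i → relCorr w a i j ≤ 1 / k) (hr' : ∀ j, j ≠ i → relCorr w a i j ≤ w j / w i) :
    a' i ≠ 0 ∧ ∀ j, relCorr w a' i j * (1 - 4 * b)
      ≤ relCorr w a i j ^ 2 + w j / w i * (2 * b) := by
  set h := ∑ l, w i / w l * relCorr w a i l ^ 2 with hh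
  have hh2 : h ≤ 2 := by
    rw [hh, ← Finset.add_sum_erase _ _ (Finset.mem_univ i), relCorr_self hw hai,
      div_self (hw i).ne']
    -- One power of the ratio cancels the weights, the other one is at most `1/k`. This is how the
    -- noise loses its factor `kγ`.
    have h1 : ∀ l ∈ Finset.univ.erase i, w i / w l * relCorr w a i l ^ 2 ≤ 1 / k := by
      intro l hl
      have hl' := Finset.ne_of_mem_erase hl
      have hwl := hw l; have hwi := hw i
      have h0 := relCorr_nonneg (a := a) (i := i) hw l
      calc w i / w l * relCorr w a i l ^ 2
          = (w i / w l * relCorr w a i l) * relCorr w a i l := by ring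
        _ ≤ (w i / w l * (w l / w i)) * relCorr w a i l :=
            mul_le_mul_of_nonneg_right
              (mul_le_mul_of_nonneg_left (hr' l hl') (by positivity)) h0
        _ = relCorr w a i l := by field_simp
        _ ≤ _ := hr l hl'
    have h2 := Finset.sum_le_card_nsmul _ _ _ h1
    have h3 : ((Finset.univ.erase i).card : ℝ) ≤ k := by
      have := Finset.card_le_univ (Finset.univ.erase i)
      rw [Fintype.card_fin] at this
      exact_mod_cast this
    rw [nsmul_eq_mul] at h2
    have hk : (0 : ℝ) < k := by exact_mod_cast Fin.pos i
    have h4 : ((Finset.univ.erase i).card : ℝ) * (1 / k) ≤ k * (1 / k) :=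
      mul_le_mul_of_nonneg_right h3 (by positivity)
    rw [mul_one_div_cancel hk.ne'] at h4
    linarith
  have hbh : b * h ≤ b * 2 := mul_le_mul_of_nonneg_left hh2 hb
  obtain ⟨h1, h2⟩ := hs.relCorr_mul_le hw hb hai hh.symm (by linarith)
  refine ⟨h1, fun j => ?_⟩
  have h3 : w j / w i * (b * h) ≤ w j / w i * (2 * b) :=
    mul_le_mul_of_nonneg_left (by linarith) (div_nonneg (hw j).le (hw i).le)
  calc _ ≤ relCorr w a' i j * (1 - 2 * b * h) :=
        mul_le_mul_of_nonneg_left (by linarith) (relCorr_nonneg hw j)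
    _ ≤ _ := h2 j
    _ ≤ _ := by linarith

end PowerStep

/-- The rate of quadratic convergence. -/
def quadRate (s : ℕ) : ℝ := 1 / 4 * (1 / 2) ^ (2 ^ s)

theorem quadRate_pos (s : ℕ) : 0 < quadRate s := by unfold quadRate; positivity

theorem quadRate_succ (s : ℕ) : quadRate (s + 1) = 4 * quadRate s ^ 2 := by
  unfold quadRate
  rw [pow_succ 2 s, pow_mul]; ring

theorem quadRate_antitone : Antitone quadRate := by
  intro s t hst
  unfold quadRate
  exact mul_le_mul_of_nonneg_left
    (pow_le_pow_of_le_one (by norm_num) (by norm_num) (Nat.pow_le_pow_right (by norm_num) hst))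
    (by norm_num)

theorem quadRate_le (s : ℕ) : quadRate s ≤ 1 / 8 := by
  have := quadRate_antitone (Nat.zero_le s)
  have h0 : quadRate 0 = 1 / 8 := by unfold quadRate; norm_num
  linarith

/-- The recursion `r ↦ r² + n` settles at the noise floor. A bound `2n + q` keeps the floor `2n`
apart from a transient that follows `q ↦ 4q²`, the recursion of `quadRate`. -/
theorem quad_step {r r' n ν q : ℝ} (hr0 : 0 ≤ r) (hr : r ≤ 2 * n + q) (hn0 : 0 ≤ n)
    (hn : n ≤ 1 / 100) (hν : ν ≤ 1 / 20) (hr'0 : 0 ≤ r') (h : r' * (1 - ν) ≤ r ^ 2 + n) :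
    r' ≤ 2 * n + 4 * q ^ 2 := by
  have h1 : r ^ 2 ≤ (2 * n + q) ^ 2 := pow_le_pow_left₀ hr0 hr 2
  have h2 : (2 * n + q) ^ 2 ≤ 8 * n ^ 2 + 2 * q ^ 2 := by nlinarith [sq_nonneg (2 * n - q)]
  have h3 : r' * (19 / 20) ≤ r' * (1 - ν) := mul_le_mul_of_nonneg_left (by linarith) hr'0
  have h4 : 8 * n ^ 2 ≤ 8 / 100 * n := by nlinarith
  nlinarith [sq_nonneg q]

/-- The whole run: a relative gap `δ` between the best and the other factors is amplified until
the correlations with the other factors are of the order of the coherence. -/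
theorem power_iteration_converges {γ β δ : ℝ} (hw : ∀ j, 0 < w j) (hγ : ∀ j l, w j ≤ γ * w l)
    (hγ1 : 1 ≤ γ) (hβ : 0 < β) (hsmall : (k : ℝ) ^ 2 * γ * β ≤ 1 / 100000)
    (hδ : 32 * (k * γ * β) ≤ δ) (hδ0 : 0 < δ) (i : Fin k) {a : ℕ → Fin k → ℝ}
    (hstep : ∀ t, PowerStep w (2 * β) i (a t) (a (t + 1)))
    (h0 : a 0 i ≠ 0) (hgap : ∀ j, j ≠ i → w j * |a 0 j| ≤ (1 - δ) * (w i * |a 0 i|))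
    {s₁ s₂ : ℕ} (hs₁ : 1 / 2 ≤ δ * (13 / 10) ^ s₁) (hs₂ : γ * quadRate s₂ ≤ β)
    {t : ℕ} (ht : s₁ + 2 + s₂ + s₂ ≤ t) :
    a t i ≠ 0 ∧ ∀ j, j ≠ i → |a t j| ≤ 9 * β * |a t i| := by
  have hk : (1 : ℝ) ≤ k := by exact_mod_cast Fin.pos i
  have hγ0 : (0 : ℝ) ≤ γ := by linarith
  set n : ℝ := 2 * β * (k * γ) with hn
  have hn0 : 0 < n := by rw [hn]; positivity
  have hkn : k * n ≤ 2 / 100000 := by rw [hn]; linarith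
  have hn1 : n ≤ 2 / 100000 := by nlinarith
  have hδn : 16 * n ≤ δ := by rw [hn]; linarith
  have hβn : 2 * β ≤ n := by
    rw [hn]
    have : 1 ≤ k * γ := by nlinarith
    nlinarith
  have hwi := hw i
  -- amplification of the gap
  have phase1 : ∀ t, a t i ≠ 0 ∧ ∀ j, j ≠ i →
      relCorr w (a t) i j ≤ 1 - min (1 / 2) (δ * (13 / 10) ^ t) := by
    intro t
    induction t with
    | zero =>
      refine ⟨h0, fun j hj => ?_⟩
      have hpos : 0 < w i * |a 0 i| := mul_pos hwi (abs_pos.2 h0)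
      have h1 : relCorr w (a 0) i j ≤ 1 - δ := by
        unfold relCorr; rw [div_le_iff₀ hpos]; exact hgap j hj
      have h2 := min_le_right (1 / 2) (δ * (13 / 10) ^ 0)
      rw [pow_zero, mul_one] at *
      linarith
    | succ t ih =>
      obtain ⟨h1, h2⟩ := ih
      have hx0 : 0 < min (1 / 2) (δ * (13 / 10 : ℝ) ^ t) := lt_min (by norm_num) (by positivity)
      have hall : ∀ j, relCorr w (a t) i j ≤ 1 := by
        intro j
        by_cases hj : j = i
        · rw [hj, relCorr_self hw h1]
        · linarith [h2 j hj]
      obtain ⟨h3, h4⟩ := (hstep t).relCorr_le_of_le_one hw (by positivity) h1 hγ hγ0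
        (by rw [← hn]; linarith) hall
      rw [← hn] at h4
      refine ⟨h3, fun j hj => ?_⟩
      set x := min (1 / 2) (δ * (13 / 10 : ℝ) ^ t) with hx
      have hx1 : x ≤ 1 / 2 := min_le_left _ _
      have hxδ : 16 * n ≤ x := by
        exact le_min (by linarith)
          (hδn.trans (le_mul_of_one_le_right hδ0.le (one_le_pow₀ (by norm_num))))
      have h5 := h4 j
      have h6 : min 1 (w j / w i) * n ≤ n := by
        have := mul_le_mul_of_nonneg_right (min_le_left 1 (w j / w i)) hn0.le
        linarith
      have h7 := h2 j hj
      have h8 := relCorr_nonneg (a := a t) (i := i) hw j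
      have h9 : relCorr w (a t) i j ^ 2 ≤ (1 - x) ^ 2 := pow_le_pow_left₀ h8 h7 2
      -- For `x ≤ 1/2`, `(1 - x)² ≤ 1 - 3x/2`; the noise costs at most `3n ≤ 3x/16 < x/5`, which
      -- leaves the growth factor `13/10`.
      have h10 : relCorr w (a (t + 1)) i j * (1 - 2 * n) ≤ (1 - 13 / 10 * x) * (1 - 2 * n) := by
        nlinarith
      have h11 := le_of_mul_le_mul_right h10 (by linarith)
      have h12 : min (1 / 2) (δ * (13 / 10 : ℝ) ^ (t + 1)) ≤ 13 / 10 * x := by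
        rw [hx, pow_succ]
        rcases min_cases (1 / 2) (δ * (13 / 10 : ℝ) ^ t) with ⟨e, _⟩ | ⟨e, _⟩
        · rw [e]; exact (min_le_left _ _).trans (by norm_num)
        · rw [e]; exact (min_le_right _ _).trans (by linarith)
      linarith
  -- from a dominating factor to a strongly dominating one
  have onestep : ∀ t r, a t i ≠ 0 → r ≤ 1 → (∀ j, j ≠ i → relCorr w (a t) i j ≤ r) →
      a (t + 1) i ≠ 0 ∧ ∀ j, relCorr w (a (t + 1)) i j * (1 - 2 * n)
        ≤ relCorr w (a t) i j ^ 2 + min 1 (w j / w i) * n := by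
    intro t r h1 hr h2
    have hall : ∀ j, relCorr w (a t) i j ≤ 1 := by
      intro j
      by_cases hj : j = i
      · rw [hj, relCorr_self hw h1]
      · linarith [h2 j hj]
    have := (hstep t).relCorr_le_of_le_one hw (by positivity) h1 hγ hγ0
        (by rw [← hn]; linarith) hall
    rwa [← hn] at this
  have hmin0 : ∀ j, 0 ≤ min 1 (w j / w i) := fun j =>
    le_min zero_le_one (div_nonneg (hw j).le hwi.le)
  have hminn : ∀ j, min 1 (w j / w i) * n ≤ n := fun j => by
    have := mul_le_mul_of_nonneg_right (min_le_left 1 (w j / w i)) hn0.le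
    linarith
  -- Two squarings lead from `1/2` through `3/10` to `1/8`, the value of `quadRate 0`.
  have phase2 : a (s₁ + 2) i ≠ 0 ∧ ∀ j, j ≠ i → relCorr w (a (s₁ + 2)) i j ≤ 1 / 8 := by
    obtain ⟨h1, h2⟩ := phase1 s₁
    rw [min_eq_left hs₁] at h2
    obtain ⟨h3, h4⟩ := onestep s₁ _ h1 (by norm_num) h2
    have h5 : ∀ j, j ≠ i → relCorr w (a (s₁ + 1)) i j ≤ 3 / 10 := by
      intro j hj
      have := h4 j
      have := hminn j
      have h8 := relCorr_nonneg (a := a s₁) (i := i) hw j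
      have h9 := relCorr_nonneg (a := a (s₁ + 1)) (i := i) hw j
      have h10 := h2 j hj
      nlinarith
    obtain ⟨h6, h7⟩ := onestep (s₁ + 1) _ h3 (by norm_num) h5
    refine ⟨h6, fun j hj => ?_⟩
    have := h7 j
    have := hminn j
    have h8 := relCorr_nonneg (a := a (s₁ + 1)) (i := i) hw j
    have h9 := relCorr_nonneg (a := a (s₁ + 1 + 1)) (i := i) hw j
    have h10 := h5 j hj
    change relCorr w (a (s₁ + 1 + 1)) i j ≤ 1 / 8
    nlinarith
  -- Quadratic convergence to a floor that still contains `kγ`.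
  have phase3 : ∀ s, a (s₁ + 2 + s) i ≠ 0 ∧ ∀ j, j ≠ i →
      relCorr w (a (s₁ + 2 + s)) i j ≤ 2 * (min 1 (w j / w i) * n) + quadRate s := by
    intro s
    induction s with
    | zero =>
      refine ⟨phase2.1, fun j hj => ?_⟩
      have h1 := phase2.2 j hj
      have h0 : quadRate 0 = 1 / 8 := by unfold quadRate; norm_num
      have := mul_nonneg (hmin0 j) hn0.le
      rw [h0]
      linarith
    | succ s ih =>
      obtain ⟨h1, h2⟩ := ih
      have hq := quadRate_le s
      obtain ⟨h3, h4⟩ := onestep (s₁ + 2 + s) 1 h1 le_rfl (fun j hj => by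
        have := h2 j hj; have := hminn j; linarith)
      refine ⟨h3, fun j hj => ?_⟩
      rw [quadRate_succ]
      exact quad_step (relCorr_nonneg hw j) (h2 j hj) (mul_nonneg (hmin0 j) hn0.le)
        (by linarith [hminn j]) (by linarith) (relCorr_nonneg hw j) (h4 j)
  have hq : ∀ s, s₂ ≤ s → ∀ j, quadRate s ≤ w j / w i * β := by
    intro s hs j
    have h1 : w i / w j ≤ γ := by rw [div_le_iff₀ (hw j)]; exact hγ i j
    have h2 : w i / w j * quadRate s ≤ β :=
      (mul_le_mul h1 (quadRate_antitone hs) (quadRate_pos s).le hγ0).trans hs₂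
    have hwj := hw j
    calc quadRate s = w j / w i * (w i / w j * quadRate s) := by field_simp
      _ ≤ _ := mul_le_mul_of_nonneg_left h2 (by positivity)
  have hq' : ∀ s, s₂ ≤ s → quadRate s ≤ β := fun s hs =>
    (quadRate_antitone hs).trans (le_trans
      (le_mul_of_one_le_left (quadRate_pos s₂).le hγ1) hs₂)
  -- After `s₂` iterations the transient is negligible, and the hypotheses of `relCorr_le_of_le_inv`
  -- hold from then on.
  have strong : ∀ s, a (s₁ + 2 + s₂ + s) i ≠ 0 ∧
      (∀ j, j ≠ i → relCorr w (a (s₁ + 2 + s₂ + s)) i j ≤ 3 * n) ∧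
      ∀ j, j ≠ i → relCorr w (a (s₁ + 2 + s₂ + s)) i j ≤ w j / w i := by
    intro s
    obtain ⟨h1, h2⟩ := phase3 (s₂ + s)
    rw [← add_assoc] at h1 h2
    refine ⟨h1, fun j hj => ?_, fun j hj => ?_⟩
    · linarith [h2 j hj, hminn j, hq' (s₂ + s) (Nat.le_add_right _ _)]
    · have hg : 0 < w j / w i := div_pos (hw j) hwi
      have h3 := hq (s₂ + s) (Nat.le_add_right _ _) j
      have h4 : min 1 (w j / w i) * n ≤ w j / w i * n :=
        mul_le_mul_of_nonneg_right (min_le_right _ _) hn0.le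
      nlinarith [h2 j hj]
  -- The clock restarts with the smaller noise `4β w_j / w_i`; another `s₂` iterations are needed,
  -- hence `s₂ + s₂` in the total.
  have phase4 : ∀ s, ∀ j, j ≠ i →
      relCorr w (a (s₁ + 2 + s₂ + s)) i j ≤ 2 * (w j / w i * (2 * (2 * β))) + quadRate s := by
    intro s
    induction s with
    | zero =>
      intro j hj
      have h0 : quadRate 0 = 1 / 8 := by unfold quadRate; norm_num
      have hg : 0 < w j / w i := div_pos (hw j) hwi
      have h1 := (strong 0).2.1 j hj
      have : 0 < 2 * (w j / w i * (2 * (2 * β))) := by positivity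
      linarith
    | succ s ih =>
      obtain ⟨h1, h2, h3⟩ := strong s
      have hinv : 3 * n ≤ 1 / k := by rw [le_div_iff₀ (by linarith)]; linarith
      obtain ⟨-, h5⟩ := (hstep (s₁ + 2 + s₂ + s)).relCorr_le_of_le_inv hw (by positivity) h1
        (by linarith) (fun j hj => (h2 j hj).trans hinv) h3
      intro j hj
      have hg : 0 < w j / w i := div_pos (hw j) hwi
      have hg1 : w j / w i ≤ γ := by rw [div_le_iff₀ hwi]; exact hγ j i
      have hγβ : γ * (2 * β) ≤ n := by rw [hn]; nlinarith [mul_nonneg hγ0 hβ.le]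
      have h6 : w j / w i * (2 * β) ≤ γ * (2 * β) :=
        mul_le_mul_of_nonneg_right hg1 (by positivity)
      rw [quadRate_succ]
      exact quad_step (relCorr_nonneg hw j) (ih j hj) (by positivity) (by linarith)
        (ν := 4 * (2 * β)) (by linarith) (relCorr_nonneg hw j) (h5 j)
  obtain ⟨s, rfl⟩ := Nat.exists_eq_add_of_le ht
  rw [add_assoc (s₁ + 2 + s₂)]
  have hai := (strong (s₂ + s)).1
  refine ⟨hai, fun j hj => ?_⟩
  have h1 := phase4 (s₂ + s) j hj
  have h2 := hq (s₂ + s) (Nat.le_add_right _ _) j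
  have hwj := hw j
  -- The floor gives `8β` and the transient `β`; the weights cancel on return to plain correlations.
  have h3 : relCorr w (a (s₁ + 2 + s₂ + (s₂ + s))) i j ≤ w j / w i * (9 * β) := by linarith
  have hpos : 0 < w i * |a (s₁ + 2 + s₂ + (s₂ + s)) i| := mul_pos hwi (abs_pos.2 hai)
  unfold relCorr at h3
  rw [div_le_iff₀ hpos] at h3
  have h4 : w j / w i * (9 * β) * (w i * |a (s₁ + 2 + s₂ + (s₂ + s)) i|)
      = w j * (9 * β * |a (s₁ + 2 + s₂ + (s₂ + s)) i|) := by field_simp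
  rw [h4] at h3
  exact le_of_mul_le_mul_left h3 hwj

end PowerDynamics

/-! ### Reduction of Orth-ALS to the power dynamics. -/

section Iteration

open InnerProductSpace

variable {d k : ℕ} {w : Fin k → ℝ} {A : Fin k → EuclideanSpace ℝ (Fin d)} {γ β : ℝ}

theorem Tensor3.contract_ofFactors (w : Fin k → ℝ) (A : Fin k → EuclideanSpace ℝ (Fin d))
    (x : EuclideanSpace ℝ (Fin d)) :
    (Tensor3.ofFactors w A).contract x = ∑ i, (w i * inner ℝ (A i) x ^ 2) • A i := by
  ext a
  have h : ∀ i, inner ℝ (A i) x = ∑ b, A i b * x b := fun i => by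
    simp [PiLp.inner_apply, mul_comm]
  simp only [Tensor3.contract, Tensor3.ofFactors, WithLp.ofLp_sum, Finset.sum_apply,
    smul_eq_mul, WithLp.ofLp_smul, Pi.smul_apply]
  calc ∑ b, ∑ c, (∑ i, w i * A i a * A i b * A i c) * x b * x c
      = ∑ b, ∑ c, ∑ i, w i * A i a * (A i b * x b) * (A i c * x c) := by
        refine Finset.sum_congr rfl fun b _ => Finset.sum_congr rfl fun c _ => ?_
        rw [Finset.sum_mul, Finset.sum_mul]
        exact Finset.sum_congr rfl fun i _ => by ring
    _ = ∑ b, ∑ i, ∑ c, w i * A i a * (A i b * x b) * (A i c * x c) :=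
        Finset.sum_congr rfl fun b _ => Finset.sum_comm
    _ = ∑ i, ∑ b, ∑ c, w i * A i a * (A i b * x b) * (A i c * x c) := Finset.sum_comm
    _ = ∑ i, w i * inner ℝ (A i) x ^ 2 * A i a := by
        refine Finset.sum_congr rfl fun i _ => ?_
        rw [h i]
        simp only [← Finset.mul_sum, ← Finset.sum_mul]
        ring

theorem Tensor3.weightEstimate_eq_inner (T : Tensor3 d) (x : EuclideanSpace ℝ (Fin d)) :
    T.weightEstimate x = inner ℝ (T.contract x) x := by
  simp only [Tensor3.weightEstimate, Tensor3.contract, PiLp.inner_apply]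
  refine Finset.sum_congr rfl fun a _ => ?_
  simp only [RCLike.inner_apply, conj_trivial, Finset.mul_sum]
  exact Finset.sum_congr rfl fun b _ => Finset.sum_congr rfl fun c _ => by ring

theorem Tensor3.weightEstimate_ofFactors (w : Fin k → ℝ) (A : Fin k → EuclideanSpace ℝ (Fin d))
    (x : EuclideanSpace ℝ (Fin d)) :
    (Tensor3.ofFactors w A).weightEstimate x = ∑ i, w i * inner ℝ (A i) x ^ 3 := by
  rw [Tensor3.weightEstimate_eq_inner, Tensor3.contract_ofFactors, sum_inner]
  exact Finset.sum_congr rfl fun i _ => by rw [real_inner_smul_left]; ring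

/-- Orthogonalization depends on the earlier estimates only through their span, so it suffices to
know that the raw estimates are near factors. -/
theorem gramSchmidt_eq_starProjection (f : Fin k → EuclideanSpace ℝ (Fin d)) (m : Fin k) :
    gramSchmidt ℝ f m
      = (Submodule.span ℝ (Set.range fun l : {l // l < m} => f l))ᗮ.starProjection (f m) := by
  have hr : (Set.range fun l : {l // l < m} => f l) = f '' Set.Iio m := by
    ext x; simp [Set.mem_image]
  rw [hr]
  symm
  apply Submodule.eq_starProjection_of_mem_orthogonal
  · rw [Submodule.mem_orthogonal]
    intro y hy
    induction hy using Submodule.span_induction with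
    | mem x hx =>
      obtain ⟨l, hl, rfl⟩ := hx
      rw [real_inner_comm]
      exact gramSchmidt_inv_triangular ℝ f hl
    | zero => simp
    | add x y _ _ hx hy => rw [inner_add_left, hx, hy, add_zero]
    | smul c x _ hx => rw [real_inner_smul_left, hx, mul_zero]
  · rw [Submodule.orthogonal_orthogonal]
    nth_rewrite 1 [gramSchmidt_def' ℝ f m]
    rw [add_sub_cancel_left, ← span_gramSchmidt_Iio ℝ f m]
    refine Submodule.sum_mem _ fun l hl => ?_
    rw [Submodule.starProjection_singleton]
    exact Submodule.smul_mem _ _ (Submodule.subset_span ⟨l, Finset.mem_Iio.1 hl, rfl⟩)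

/-- Both normalizations only contribute a positive scalar, which is invisible in ratios of
correlations. If the image vanishes, any `c` serves. -/
theorem exists_powerUpdate_gramSchmidtNormed_eq (w : Fin k → ℝ)
    (A f : Fin k → EuclideanSpace ℝ (Fin d)) (m : Fin k) :
    ∃ c : ℝ, 0 < c ∧ powerUpdate (Tensor3.ofFactors w A) (gramSchmidtNormed ℝ f m)
      = c • ∑ j, (w j * inner ℝ (A j) (gramSchmidt ℝ f m) ^ 2) • A j := by
  set q := gramSchmidt ℝ f m with hq
  set y := ∑ j, (w j * inner ℝ (A j) q ^ 2) • A j with hy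
  have h1 : (Tensor3.ofFactors w A).contract (gramSchmidtNormed ℝ f m) = (‖q‖⁻¹ ^ 2) • y := by
    rw [Tensor3.contract_ofFactors, hy, Finset.smul_sum]
    refine Finset.sum_congr rfl fun j _ => ?_
    rw [gramSchmidtNormed, ← hq, real_inner_smul_right, smul_smul]
    congr 1
    simp only [RCLike.ofReal_real_eq_id, id]
    ring
  unfold powerUpdate
  rw [h1]
  by_cases hy0 : y = 0
  · exact ⟨1, one_pos, by simp [hy0]⟩
  · have hq0 : q ≠ 0 := by
      rintro h
      apply hy0
      rw [hy]
      refine Finset.sum_eq_zero fun j _ => by simp [h]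
    have hq1 : 0 < ‖q‖ := norm_pos_iff.2 hq0
    have hy1 : 0 < ‖y‖ := norm_pos_iff.2 hy0
    refine ⟨‖(‖q‖⁻¹ ^ 2) • y‖⁻¹ * (‖q‖⁻¹ ^ 2), ?_, by rw [smul_smul]⟩
    have : 0 < ‖(‖q‖⁻¹ ^ 2) • y‖ := by
      rw [norm_pos_iff]
      exact smul_ne_zero (by positivity) hy0
    positivity

theorem orthALS_succ (T : Tensor3 d) (N : ℕ) (u : Fin k → EuclideanSpace ℝ (Fin d)) {t : ℕ}
    {m : Fin k} (h : (m : ℕ) * N ≤ t) :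
    orthALS T N u (t + 1) m = powerUpdate T (gramSchmidtNormed ℝ (orthALS T N u t) m) := by
  exact if_pos h

theorem orthALS_start (T : Tensor3 d) (N : ℕ) (u : Fin k → EuclideanSpace ℝ (Fin d)) (m : Fin k) :
    orthALS T N u (m * N) m = u m := by
  rcases h : (m : ℕ) * N with _ | t
  · rfl
  · exact if_neg (by omega)

/-- The correlations of the factors with the `m`-th orthogonalized estimate. -/
def corr (A f : Fin k → EuclideanSpace ℝ (Fin d)) (m j : Fin k) : ℝ :=
  inner ℝ (A j) (gramSchmidt ℝ f m)

/-- The orthogonalization of iterate `t + 1` uses the earlier estimates of that same iterate, so `G`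
is their Gram matrix and their motion in between does no harm. Its diagonal may nearly vanish at
recovered factors, which is why only `G i i` has a lower bound near 1. -/
theorem powerStep_corr (h : Regular w A γ β) {N t : ℕ} {u : Fin k → EuclideanSpace ℝ (Fin d)}
    {m : Fin k} (ht : (m : ℕ) * N ≤ t) {σ : {l // l < m} → Fin k}
    (hX : NearFactors w A β σ fun l => orthALS (Tensor3.ofFactors w A) N u (t + 1) l)
    {i : Fin k} (hi : ∀ l, i ≠ σ l) :
    PowerStep w (2 * β) i (corr A (orthALS (Tensor3.ofFactors w A) N u t) m)
      (corr A (orthALS (Tensor3.ofFactors w A) N u (t + 1)) m) := by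
  obtain ⟨c, hc, he⟩ :=
    exists_powerUpdate_gramSchmidtNormed_eq w A (orthALS (Tensor3.ofFactors w A) N u t) m
  refine ⟨c, hc, NearFactors.gram A fun l : {l // l < m} =>
    orthALS (Tensor3.ofFactors w A) N u (t + 1) l, fun j l hjl => hX.abs_gram_le h hjl,
    fun j => ⟨NearFactors.gram_self_nonneg j, NearFactors.gram_self_le h j⟩,
    hX.le_gram_self h hi, fun j => ?_⟩
  rw [corr, gramSchmidt_eq_starProjection, orthALS_succ _ _ _ ht, he, map_smul,
    real_inner_smul_right, map_sum, inner_sum]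
  congr 1
  refine Finset.sum_congr rfl fun l _ => ?_
  rw [map_smul, real_inner_smul_right]
  rfl

namespace Regular

theorem linearIndependent (h : Regular w A γ β) : LinearIndependent ℝ A :=
  linearIndependent_of_nearly_orthonormal h.norm_eq h.coh h.beta_pos.le
    (by rw [Fintype.card_fin]; linarith [h.card_mul_le])

end Regular

/-- The coefficients are `ρ j = a j / a i`. Linear independence of the factors rules out a zero
image, so the update really has norm one. -/
theorem nearFactor_of_corr (h : Regular w A γ β) {N t : ℕ} {u : Fin k → EuclideanSpace ℝ (Fin d)}
    {m i : Fin k} (ht : (m : ℕ) * N ≤ t)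
    (hi : corr A (orthALS (Tensor3.ofFactors w A) N u t) m i ≠ 0)
    (hc : ∀ j, j ≠ i → |corr A (orthALS (Tensor3.ofFactors w A) N u t) m j|
      ≤ 9 * β * |corr A (orthALS (Tensor3.ofFactors w A) N u t) m i|) :
    NearFactor w A β i (orthALS (Tensor3.ofFactors w A) N u (t + 1) m) := by
  obtain ⟨c, hc0, he⟩ :=
    exists_powerUpdate_gramSchmidtNormed_eq w A (orthALS (Tensor3.ofFactors w A) N u t) m
  set a := corr A (orthALS (Tensor3.ofFactors w A) N u t) m with ha
  have he' : orthALS (Tensor3.ofFactors w A) N u (t + 1) m = c • ∑ j, (w j * a j ^ 2) • A j := by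
    rw [orthALS_succ _ _ _ ht, he]; rfl
  have hy : ∑ j, (w j * a j ^ 2) • A j ≠ 0 := by
    intro h0
    have := Fintype.linearIndependent_iff.1 h.linearIndependent _ h0 i
    have hwi := h.pos i
    exact (by positivity : w i * a i ^ 2 ≠ 0) this
  refine ⟨?_, (c * a i ^ 2)⁻¹, by positivity, fun j => a j / a i, div_self hi, fun j hj => ?_, ?_⟩
  · have hne : orthALS (Tensor3.ofFactors w A) N u (t + 1) m ≠ 0 := by
      rw [he']; exact smul_ne_zero hc0.ne' hy
    rw [orthALS_succ _ _ _ ht] at hne ⊢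
    unfold powerUpdate at hne ⊢
    rw [norm_smul, norm_inv, norm_norm]
    refine inv_mul_cancel₀ fun h0 => hne ?_
    rw [norm_eq_zero.1 h0, smul_zero]
  · rw [abs_div, div_le_iff₀ (abs_pos.2 hi)]; exact hc j hj
  · rw [he', smul_smul, Finset.smul_sum]
    refine Finset.sum_congr rfl fun j _ => ?_
    rw [smul_smul]
    congr 1
    field_simp

/-- Among the correlations `y`, that of some factor exceeds all others by a relative gap `δ`. -/
def HasGap (w : Fin k → ℝ) (δ : ℝ) (y : Fin k → ℝ) : Prop :=
  ∃ i, y i ≠ 0 ∧ ∀ j, j ≠ i → w j * |y j| ≤ (1 - δ) * (w i * |y i|)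

/-- The correlations of the factors with the `m`-th estimate when it is started. -/
def startCorr (w : Fin k → ℝ) (A : Fin k → EuclideanSpace ℝ (Fin d)) (N : ℕ)
    (u : Fin k → EuclideanSpace ℝ (Fin d)) (m : Fin k) : Fin k → ℝ :=
  corr A (orthALS (Tensor3.ofFactors w A) N u (m * N)) m

theorem exists_nearFactor_of_hasGap (h : Regular w A γ β) {δ : ℝ} (hδ : 32 * (k * γ * β) ≤ δ)
    (hδ0 : 0 < δ) {s₁ s₂ : ℕ} (hs₁ : 1 / 2 ≤ δ * (13 / 10) ^ s₁) (hs₂ : γ * quadRate s₂ ≤ β)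
    {N : ℕ} {u : Fin k → EuclideanSpace ℝ (Fin d)} {m : Fin k} {σ : {l // l < m} → Fin k}
    (hX : ∀ t, (m : ℕ) * N ≤ t →
      NearFactors w A β σ fun l => orthALS (Tensor3.ofFactors w A) N u t l)
    (hgap : HasGap w δ (startCorr w A N u m)) :
    ∃ i, (∀ l, i ≠ σ l) ∧ ∀ s, s₁ + 3 + s₂ + s₂ ≤ s →
      NearFactor w A β i (orthALS (Tensor3.ofFactors w A) N u (m * N + s) m) := by
  obtain ⟨i, hi0, hi⟩ := hgap
  have hpos : 0 < w i * |startCorr w A N u m i| := mul_pos (h.pos i) (abs_pos.2 hi0)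
  -- A leading recovered factor would have a positive weighted correlation bounded by half of
  -- itself.
  have hnew : ∀ l, i ≠ σ l := by
    rintro l rfl
    have hq : inner ℝ (orthALS (Tensor3.ofFactors w A) N u (m * N) l)
        (gramSchmidt ℝ (orthALS (Tensor3.ofFactors w A) N u (m * N)) m) = 0 := by
      rw [real_inner_comm]; exact gramSchmidt_inv_triangular ℝ _ l.2
    have := ((hX _ le_rfl).near l).weighted_inner_le h hq
      (M := w (σ l) * |startCorr w A N u m (σ l)|) (fun j => by
        by_cases hj : j = σ l
        · rw [hj]; rfl
        · have := hi j hj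
          change w j * |startCorr w A N u m j| ≤ _
          nlinarith)
    change w (σ l) * |startCorr w A N u m (σ l)| ≤ _ at this
    linarith
  refine ⟨i, hnew, fun s hs => ?_⟩
  -- Small correlations at one iterate show in the estimate at the next, whence 3 in place of 2.
  obtain ⟨s, rfl⟩ : ∃ s', s = s' + 1 := ⟨s - 1, by omega⟩
  obtain ⟨h1, h2⟩ := power_iteration_converges h.pos h.ratio h.one_le h.beta_pos h.small hδ hδ0 i
    (a := fun t => corr A (orthALS (Tensor3.ofFactors w A) N u (m * N + t)) m)
    (fun t => powerStep_corr h (Nat.le_add_right _ _) (hX _ (by omega)) hnew) hi0 hi hs₁ hs₂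
    (t := s) (by omega)
  exact nearFactor_of_corr h (Nat.le_add_right _ _) h1 h2

/-- If every one of the first `n` estimates starts with a gap, then these estimates converge to
distinct factors. -/
theorem exists_nearFactors_of_hasGap (h : Regular w A γ β) {δ : ℝ} (hδ : 32 * (k * γ * β) ≤ δ)
    (hδ0 : 0 < δ) {s₁ s₂ : ℕ} (hs₁ : 1 / 2 ≤ δ * (13 / 10) ^ s₁) (hs₂ : γ * quadRate s₂ ≤ β)
    {N : ℕ} (hN : s₁ + 3 + s₂ + s₂ ≤ N) {u : Fin k → EuclideanSpace ℝ (Fin d)} (n : ℕ)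
    (hn : n ≤ k) (hgap : ∀ m : Fin k, (m : ℕ) < n → HasGap w δ (startCorr w A N u m)) :
    ∃ σ : Fin k → Fin k,
      (∀ l l' : Fin k, (l : ℕ) < n → (l' : ℕ) < n → σ l = σ l' → l = l') ∧
      ∀ l : Fin k, (l : ℕ) < n → ∀ s, s₁ + 3 + s₂ + s₂ ≤ s →
        NearFactor w A β (σ l) (orthALS (Tensor3.ofFactors w A) N u (l * N + s) l) := by
  induction n with
  | zero => exact ⟨id, fun _ _ h => absurd h (Nat.not_lt_zero _), fun _ h => absurd h (Nat.not_lt_zero _)⟩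
  | succ n ih =>
    obtain ⟨σ, hσ, hnear⟩ := ih (by omega) fun m hm => hgap m (by omega)
    set m : Fin k := ⟨n, hn⟩ with hm
    have hX : ∀ t, (m : ℕ) * N ≤ t → NearFactors w A β (fun l : {l // l < m} => σ l)
        fun l : {l // l < m} => orthALS (Tensor3.ofFactors w A) N u t l := by
      intro t ht
      refine ⟨fun l => ?_, fun l l' hll => Subtype.ext (hσ l l' l.2 l'.2 hll)⟩
      have hl : ((l : Fin k) : ℕ) < n := l.2
      -- By the start of column `m`, every earlier column has had at least `N` updates of its own
      -- and has settled.
      have h1 : ((l : Fin k) : ℕ) * N + N ≤ m * N := by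
        rw [← Nat.succ_mul]; exact Nat.mul_le_mul_right _ hl
      have := hnear l hl (t - (l : Fin k) * N) (by omega)
      rwa [Nat.add_sub_cancel' (by omega)] at this
    obtain ⟨i, hi, hi'⟩ := exists_nearFactor_of_hasGap h hδ hδ0 hs₁ hs₂ hX (hgap m (by simp [hm]))
    have hlt : ∀ l : Fin k, (l : ℕ) < n + 1 → l ≠ m → (l : ℕ) < n := by
      intro l hl hne
      have : (l : ℕ) ≠ n := fun e => hne (Fin.ext e)
      omega
    refine ⟨Function.update σ m i, ?_, ?_⟩
    · intro l l' hl hl' he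
      by_cases h1 : l = m <;> by_cases h2 : l' = m
      · rw [h1, h2]
      · rw [h1, Function.update_self, Function.update_of_ne h2] at he
        exact absurd he (hi ⟨l', hlt l' hl' h2⟩)
      · rw [h2, Function.update_self, Function.update_of_ne h1] at he
        exact absurd he.symm (hi ⟨l, hlt l hl h1⟩)
      · rw [Function.update_of_ne h2, Function.update_of_ne h1] at he
        exact hσ l l' (hlt l hl h1) (hlt l' hl' h2) he
    · intro l hl s hs
      by_cases h1 : l = m
      · rw [h1, Function.update_self]; exact hi' s hs
      · rw [Function.update_of_ne h1]; exact hnear l (hlt l hl h1) s hs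

end Iteration

/-! ### Anticoncentration: small gaps between the top correlations are unlikely. -/

section Anticoncentration

open Metric
open scoped Pointwise

variable {d : ℕ}

/-- Spherical caps of the unit ball are exponentially small. -/
theorem volume_cap_le {v : EuclideanSpace ℝ (Fin d)} (hv : ‖v‖ ≤ 1) {s : ℝ} (hs : 0 ≤ s) :
    (volume : Measure (EuclideanSpace ℝ (Fin d))).real (ball 0 1 ∩ {x | s < inner ℝ v x})
      ≤ Real.exp (-(d * s ^ 2 / 2)) *
        (volume : Measure (EuclideanSpace ℝ (Fin d))).real (ball 0 1) := by
  -- On the cap, `‖x - s v‖² ≤ 1 - 2s² + s² ≤ exp(-s²)`, so a ball of smaller radius covers it.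
  have hsub : ball 0 1 ∩ {x | s < inner ℝ v x}
      ⊆ closedBall (s • v) (Real.exp (-(s ^ 2 / 2))) := by
    rintro x ⟨hx, hx'⟩
    rw [mem_ball_zero_iff] at hx
    rw [mem_closedBall, dist_eq_norm]
    have hx' : s < inner ℝ v x := hx'
    refine le_of_sq_le_sq ?_ (Real.exp_nonneg _)
    rw [norm_sub_sq_real, real_inner_smul_right, norm_smul, Real.norm_eq_abs, mul_pow, sq_abs,
      ← Real.exp_nat_mul, real_inner_comm]
    have h1 : ‖x‖ ^ 2 ≤ 1 := pow_le_one₀ (norm_nonneg _) hx.le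
    have h2 : s ^ 2 * ‖v‖ ^ 2 ≤ s ^ 2 :=
      mul_le_of_le_one_right (sq_nonneg _) (pow_le_one₀ (norm_nonneg _) hv)
    have h3 := Real.add_one_le_exp (((2 : ℕ) : ℝ) * -(s ^ 2 / 2))
    push_cast at h3 ⊢
    nlinarith
  refine (measureReal_mono hsub (measure_closedBall_lt_top.ne)).trans ?_
  rw [Measure.addHaar_real_closedBall _ _ (Real.exp_nonneg _), finrank_euclideanSpace,
    Fintype.card_fin, ← Real.exp_nat_mul]
  apply le_of_eq
  congr 2
  ring

theorem volume_abs_cap_le {v : EuclideanSpace ℝ (Fin d)} (hv : ‖v‖ ≤ 1) {s : ℝ} (hs : 0 ≤ s) :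
    (volume : Measure (EuclideanSpace ℝ (Fin d))).real (ball 0 1 ∩ {x | s < |inner ℝ v x|})
      ≤ 2 * Real.exp (-(d * s ^ 2 / 2)) *
        (volume : Measure (EuclideanSpace ℝ (Fin d))).real (ball 0 1) := by
  have h1 := volume_cap_le hv hs
  have h2 := volume_cap_le (v := -v) (by rwa [norm_neg]) hs
  have hsub : ball 0 1 ∩ {x | s < |inner ℝ v x|} ⊆
      (ball 0 1 ∩ {x | s < inner ℝ v x}) ∪ (ball 0 1 ∩ {x | s < inner ℝ (-v) x}) := by
    rintro x ⟨hx, hx'⟩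
    rcases lt_abs.1 (show s < |inner ℝ v x| from hx') with h | h
    · exact Or.inl ⟨hx, h⟩
    · exact Or.inr ⟨hx, show s < inner ℝ (-v) x by rw [inner_neg_left]; exact h⟩
  refine (measureReal_mono hsub ?_).trans ((measureReal_union_le _ _).trans (by linarith))
  rw [← Set.inter_union_distrib_left]
  exact ((measure_mono Set.inter_subset_left).trans_lt measure_ball_lt_top).ne

variable {ι : Type*} [Fintype ι] {w : ι → ℝ} {v z : ι → EuclideanSpace ℝ (Fin d)} {δ ℓ t : ℝ}

/-- The vectors whose largest weighted correlation is the `i`-th one. -/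
def argmaxCone (w : ι → ℝ) (v : ι → EuclideanSpace ℝ (Fin d)) (i : ι) :
    Set (EuclideanSpace ℝ (Fin d)) :=
  {x | ∀ j, j ≠ i → w j * |inner ℝ (v j) x| < w i * |inner ℝ (v i) x|}

/-- The vectors whose largest weighted correlation is the `i`-th one, by a relative gap of less
than `δ`. -/
def smallGap (w : ι → ℝ) (v : ι → EuclideanSpace ℝ (Fin d)) (δ : ℝ) (i : ι) :
    Set (EuclideanSpace ℝ (Fin d)) :=
  {x | inner ℝ (v i) x ≠ 0 ∧ (∀ j, w j * |inner ℝ (v j) x| ≤ w i * |inner ℝ (v i) x|) ∧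
    ∃ j, j ≠ i ∧ (1 - δ) * (w i * |inner ℝ (v i) x|) < w j * |inner ℝ (v j) x|}

/-- The part of `smallGap` in the unit ball where the correlations have their typical size. -/
def smallGapCore (w : ι → ℝ) (v z : ι → EuclideanSpace ℝ (Fin d)) (δ ℓ : ℝ) (i : ι) :
    Set (EuclideanSpace ℝ (Fin d)) :=
  smallGap w v δ i ∩ (ball 0 1 ∩ ({x | |inner ℝ (v i) x| ≤ ℓ} ∩ {x | |inner ℝ (z i) x| ≤ 2 * ℓ}))

theorem measurableSet_argmaxCone (i : ι) : MeasurableSet (argmaxCone w v i) := by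
  have : argmaxCone w v i
      = ⋂ j, {x | j ≠ i → w j * |inner ℝ (v j) x| < w i * |inner ℝ (v i) x|} := by
    ext x; simp [argmaxCone]
  rw [this]
  refine MeasurableSet.iInter fun j => ?_
  by_cases hj : j = i
  · simp [hj]
  · simp only [ne_eq, hj, not_false_eq_true, forall_const]
    exact measurableSet_lt (by fun_prop) (by fun_prop)

theorem measurableSet_smallGap (i : ι) : MeasurableSet (smallGap w v δ i) := by
  have : smallGap w v δ i = {x | inner ℝ (v i) x = 0}ᶜ ∩
      ((⋂ j, {x | w j * |inner ℝ (v j) x| ≤ w i * |inner ℝ (v i) x|}) ∩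
      ⋃ j, {x | j ≠ i ∧ (1 - δ) * (w i * |inner ℝ (v i) x|) < w j * |inner ℝ (v j) x|}) := by
    ext x; simp [smallGap]
  rw [this]
  refine (measurableSet_eq_fun (by fun_prop) (by fun_prop)).compl.inter
    ((MeasurableSet.iInter fun j => measurableSet_le (by fun_prop) (by fun_prop)).inter
      (MeasurableSet.iUnion fun j => ?_))
  by_cases hj : j = i
  · simp [hj]
  · simp only [ne_eq, hj, not_false_eq_true, true_and]
    exact measurableSet_lt (by fun_prop) (by fun_prop)

theorem measurableSet_smallGapCore (i : ι) : MeasurableSet (smallGapCore w v z δ ℓ i) :=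
  (measurableSet_smallGap i).inter (measurableSet_ball.inter
    ((measurableSet_le (by fun_prop) (by fun_prop)).inter
      (measurableSet_le (by fun_prop) (by fun_prop))))

/-- The linear map that multiplies the correlation with `v` by `c`, along `z`. -/
def stretch (v z : EuclideanSpace ℝ (Fin d)) (c : ℝ) :
    EuclideanSpace ℝ (Fin d) →ₗ[ℝ] EuclideanSpace ℝ (Fin d) :=
  LinearMap.transvection (innerₛₗ ℝ v) ((c - 1) • z)

theorem stretch_apply (v z : EuclideanSpace ℝ (Fin d)) (c : ℝ) (x : EuclideanSpace ℝ (Fin d)) :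
    stretch v z c x = x + ((c - 1) * inner ℝ v x) • z := by
  simp [stretch, LinearMap.transvection.apply, smul_smul, mul_comm]

theorem det_stretch {v z : EuclideanSpace ℝ (Fin d)} (h : inner ℝ v z = 1) (c : ℝ) :
    LinearMap.det (stretch v z c) = c := by
  rw [stretch, LinearMap.transvection.det]
  simp [h]

theorem inner_stretch {v z : EuclideanSpace ℝ (Fin d)} (h : inner ℝ v z = 1) (c : ℝ)
    (x : EuclideanSpace ℝ (Fin d)) : inner ℝ v (stretch v z c x) = c * inner ℝ v x := by
  rw [stretch_apply, inner_add_right, real_inner_smul_right, h]; ring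

theorem inner_stretch_of_orthogonal {v v' z : EuclideanSpace ℝ (Fin d)} (h : inner ℝ v' z = 0)
    (c : ℝ) (x : EuclideanSpace ℝ (Fin d)) : inner ℝ v' (stretch v z c x) = inner ℝ v' x := by
  rw [stretch_apply, inner_add_right, real_inner_smul_right, h]; ring

/-- Stretching the small-gap region repeatedly gives disjoint subsets of the cone on which the
`i`-th correlation is the largest, so the region is small. -/
theorem card_mul_volume_smallGapCore_le (hd : 1 ≤ d) (hw : ∀ i, 0 < w i)
    (hvz : ∀ i, inner ℝ (v i) (z i) = 1) (hvz' : ∀ i j, j ≠ i → inner ℝ (v j) (z i) = 0)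
    (hz : ∀ i, ‖z i‖ ≤ 2) (hδ0 : 0 < δ) (hδ1 : δ < 1) (ht0 : 0 ≤ t) (ht1 : t ≤ 1)
    (hℓ : 0 ≤ ℓ) (hℓt : t * ℓ ^ 2 * d ≤ 1) {n : ℕ} (hn : (1 - δ)⁻¹ ^ n ≤ 1 + t) (i : ι) :
    n * (volume : Measure (EuclideanSpace ℝ (Fin d))).real (smallGapCore w v z δ ℓ i)
      ≤ Real.exp 4 * (volume : Measure (EuclideanSpace ℝ (Fin d))).real
        (argmaxCone w v i ∩ ball 0 1) := by
  set μ : Measure (EuclideanSpace ℝ (Fin d)) := volume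
  set lam : ℝ := (1 - δ)⁻¹ with hlam
  have hδ' : 0 < 1 - δ := by linarith
  have hlam1 : 1 < lam := (one_lt_inv₀ hδ').2 (by linarith)
  have hlam0 : 0 < lam := by linarith
  set S := smallGapCore w v z δ ℓ i
  set D : ℕ → EuclideanSpace ℝ (Fin d) →ₗ[ℝ] EuclideanSpace ℝ (Fin d) :=
    fun p => stretch (v i) (z i) (lam ^ p)
  have hpow : ∀ p : ℕ, 1 ≤ lam ^ p := fun p => one_le_pow₀ hlam1.le
  have hdet : ∀ p, LinearMap.det (D p) = lam ^ p := fun p => det_stretch (hvz i) _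
  have hd' : (0 : ℝ) < d := by exact_mod_cast hd
  -- A stretched vector has squared norm less than `1 + 4tℓ² + 4t²ℓ² ≤ 1 + 8/d ≤ R²`, and the
  -- enlarged ball costs the factor `R^d = e⁴`.
  set R : ℝ := Real.exp (4 / d)
  -- the images lie in the cone
  have himg : ∀ p ∈ Finset.Icc 1 n, D p '' S ⊆ argmaxCone w v i ∩ ball 0 R := by
    rintro p hp _ ⟨x, ⟨⟨hx0, hx1, -⟩, hxB, hxy, hxz⟩, rfl⟩
    have hp' := Finset.mem_Icc.1 hp
    have hc1 : 1 < lam ^ p := one_lt_pow₀ hlam1 (by omega)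
    have hct : lam ^ p ≤ 1 + t := (pow_le_pow_right₀ hlam1.le hp'.2).trans hn
    refine ⟨fun j hj => ?_, ?_⟩
    · rw [inner_stretch (hvz i), inner_stretch_of_orthogonal (hvz' i j hj), abs_mul,
        abs_of_pos (show 0 < lam ^ p by positivity)]
      have hpos : 0 < w i * |inner ℝ (v i) x| := mul_pos (hw i) (abs_pos.2 hx0)
      nlinarith [hx1 j]
    · rw [mem_ball_zero_iff] at hxB ⊢
      have hxy : |inner ℝ (v i) x| ≤ ℓ := hxy
      have hxz : |inner ℝ (z i) x| ≤ 2 * ℓ := hxz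
      refine lt_of_pow_lt_pow_left₀ 2 (Real.exp_nonneg _) ?_
      change ‖stretch (v i) (z i) (lam ^ p) x‖ ^ 2 < _
      rw [stretch_apply, norm_add_sq_real, real_inner_smul_right, norm_smul, Real.norm_eq_abs,
        mul_pow, sq_abs, ← Real.exp_nat_mul, real_inner_comm (z i) x]
      have h1 : ‖x‖ ^ 2 < 1 := pow_lt_one₀ (norm_nonneg _) hxB (by norm_num)
      have h2 : (lam ^ p - 1) * inner ℝ (v i) x * inner ℝ (z i) x ≤ t * (ℓ * (2 * ℓ)) := by
        refine (le_abs_self _).trans ?_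
        rw [mul_assoc, abs_mul, abs_mul, abs_of_nonneg (by linarith)]
        exact mul_le_mul (by linarith)
          (mul_le_mul hxy hxz (abs_nonneg _) hℓ) (by positivity) ht0
      have h3 : ((lam ^ p - 1) * inner ℝ (v i) x) ^ 2 * ‖z i‖ ^ 2 ≤ (t * ℓ) ^ 2 * 2 ^ 2 := by
        refine mul_le_mul ?_ (pow_le_pow_left₀ (norm_nonneg _) (hz i) 2) (by positivity)
          (by positivity)
        rw [← sq_abs, abs_mul, abs_of_nonneg (by linarith)]
        exact pow_le_pow_left₀ (mul_nonneg (by linarith) (abs_nonneg _))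
          (mul_le_mul (by linarith) hxy (abs_nonneg _) ht0) 2
      have h4 : t * ℓ ^ 2 ≤ 1 / d := by rw [le_div_iff₀ hd']; exact hℓt
      have h5 : (t * ℓ) ^ 2 ≤ t * ℓ ^ 2 := by
        rw [mul_pow]
        exact mul_le_mul_of_nonneg_right (by nlinarith) (sq_nonneg _)
      have h6 := Real.add_one_le_exp (((2 : ℕ) : ℝ) * (4 / d))
      have h7 : ((2 : ℕ) : ℝ) * (4 / d) = 8 * (1 / d) := by push_cast; ring
      rw [h7] at h6 ⊢
      nlinarith
  -- the images are disjoint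
  have hlt : ∀ p q : ℕ, p < q → Disjoint (D p '' S) (D q '' S) := by
    intro p q hpq
    rw [Set.disjoint_left]
    rintro _ ⟨x, ⟨⟨-, -, j, hj, hxj⟩, -⟩, rfl⟩ ⟨x', ⟨⟨-, hx', -⟩, -⟩, he⟩
    have h1 : inner ℝ (v j) x' = inner ℝ (v j) x := by
      have := congrArg (inner ℝ (v j)) he
      rwa [inner_stretch_of_orthogonal (hvz' i j hj), inner_stretch_of_orthogonal (hvz' i j hj)]
        at this
    have h2 : lam ^ q * |inner ℝ (v i) x'| = lam ^ p * |inner ℝ (v i) x| := by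
      have := congrArg (fun y => |inner ℝ (v i) y|) he
      simp only [D] at this
      rwa [inner_stretch (hvz i), inner_stretch (hvz i), abs_mul, abs_mul,
        abs_of_pos (show 0 < lam ^ q by positivity), abs_of_pos (show 0 < lam ^ p by positivity)]
        at this
    -- The two preimages agree in all correlations but the `i`-th, which is smaller at `x'` by a
    -- factor of at least `1 - δ`. The competitor `j` that nearly ties at `x` would then win at
    -- `x'`.
    have h3 : lam * |inner ℝ (v i) x'| ≤ |inner ℝ (v i) x| := by
      have h4 : lam ^ p * (lam * |inner ℝ (v i) x'|) ≤ lam ^ p * |inner ℝ (v i) x| := by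
        rw [← h2, ← mul_assoc, ← pow_succ]
        exact mul_le_mul_of_nonneg_right (pow_le_pow_right₀ hlam1.le hpq) (abs_nonneg _)
      exact le_of_mul_le_mul_left h4 (by positivity)
    have h5 : |inner ℝ (v i) x'| ≤ (1 - δ) * |inner ℝ (v i) x| := by
      have : (1 - δ) * (lam * |inner ℝ (v i) x'|) = |inner ℝ (v i) x'| := by
        rw [← mul_assoc, hlam, mul_inv_cancel₀ hδ'.ne', one_mul]
      rw [← this]
      exact mul_le_mul_of_nonneg_left h3 hδ'.le
    have h6 := hx' j
    rw [h1] at h6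
    have h7 := mul_le_mul_of_nonneg_left h5 (hw i).le
    nlinarith
  have hdisj : (↑(Finset.Icc 1 n) : Set ℕ).PairwiseDisjoint fun p => D p '' S := by
    intro p _ q _ hpq
    rcases lt_or_gt_of_ne hpq with h | h
    · exact hlt p q h
    · exact (hlt q p h).symm
  have hinj : ∀ p, Function.Injective (D p) := fun p =>
    ((LinearMap.isUnit_iff_isUnit_det (D p)).2
      (by rw [hdet]; exact (by positivity : lam ^ p ≠ 0).isUnit) |>
        (Module.End.isUnit_iff _).1).1
  have hmeas : ∀ p ∈ Finset.Icc 1 n, MeasurableSet (D p '' S) := fun p _ =>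
    (measurableSet_smallGapCore i).image_of_continuousOn_injOn
      (D p).continuous_of_finiteDimensional.continuousOn (hinj p).injOn
  have hfinB : ∀ r : ℝ, μ (argmaxCone w v i ∩ ball 0 r) ≠ ⊤ := fun r =>
    ((measure_mono Set.inter_subset_right).trans_lt measure_ball_lt_top).ne
  have hvol : ∀ p, μ.real S ≤ μ.real (D p '' S) := by
    intro p
    rw [measureReal_def, measureReal_def, Measure.addHaar_image_linearMap, hdet,
      ENNReal.toReal_mul, ENNReal.toReal_ofReal (abs_nonneg _), abs_of_pos (by positivity)]
    exact le_mul_of_one_le_left ENNReal.toReal_nonneg (hpow p)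
  have hsum : n * μ.real S ≤ μ.real (argmaxCone w v i ∩ ball 0 R) := by
    calc n * μ.real S = ∑ _p ∈ Finset.Icc 1 n, μ.real S := by simp
      _ ≤ ∑ p ∈ Finset.Icc 1 n, μ.real (D p '' S) := Finset.sum_le_sum fun p _ => hvol p
      _ = μ.real (⋃ p ∈ Finset.Icc 1 n, D p '' S) := by
          rw [measureReal_biUnion_finset hdisj hmeas fun p hp =>
            ((measure_mono (himg p hp)).trans_lt (hfinB R).lt_top).ne]
      _ ≤ _ := measureReal_mono (Set.iUnion₂_subset himg) (hfinB R)
  refine hsum.trans ?_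
  have hR : 0 < R := Real.exp_pos _
  have hcone : argmaxCone w v i ∩ ball 0 R ⊆ R • (argmaxCone w v i ∩ ball 0 1) := by
    rintro x ⟨hx, hxR⟩
    rw [Set.mem_smul_set_iff_inv_smul_mem₀ hR.ne']
    have hRi : 0 < R⁻¹ := by positivity
    refine ⟨fun j hj => ?_, ?_⟩
    · rw [real_inner_smul_right, real_inner_smul_right, abs_mul, abs_mul, abs_of_pos hRi]
      nlinarith [hx j hj]
    · rw [mem_ball_zero_iff] at hxR ⊢
      rw [norm_smul, Real.norm_eq_abs, abs_of_pos hRi, inv_mul_lt_iff₀ hR, mul_one]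
      exact hxR
  have hfinR : μ (R • (argmaxCone w v i ∩ ball 0 1)) ≠ ⊤ := by
    rw [Measure.addHaar_smul]
    exact ENNReal.mul_ne_top ENNReal.ofReal_ne_top (hfinB 1)
  refine (measureReal_mono hcone hfinR).trans (le_of_eq ?_)
  rw [measureReal_def, measureReal_def, Measure.addHaar_smul_of_nonneg _ hR.le,
    ENNReal.toReal_mul, ENNReal.toReal_ofReal (by positivity), finrank_euclideanSpace,
    Fintype.card_fin, ← Real.exp_nat_mul]
  congr 2
  field_simp

/-- The vectors whose weighted correlations have no relative gap `δ` at the top. -/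
def noGap (w : ι → ℝ) (v : ι → EuclideanSpace ℝ (Fin d)) (δ : ℝ) :
    Set (EuclideanSpace ℝ (Fin d)) :=
  {x | ¬ ∃ i, inner ℝ (v i) x ≠ 0 ∧
    ∀ j, j ≠ i → w j * |inner ℝ (v j) x| ≤ (1 - δ) * (w i * |inner ℝ (v i) x|)}

/-- Each core is charged to its own cone, and the cones are disjoint, so the main term has no factor
`card ι`. The union bound is spent only on the exponentially small tails. -/
theorem volume_noGap_le [Nonempty ι] (hd : 1 ≤ d) (hw : ∀ i, 0 < w i)
    (hv : ∀ i, ‖v i‖ ≤ 1)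
    (hvz : ∀ i, inner ℝ (v i) (z i) = 1) (hvz' : ∀ i j, j ≠ i → inner ℝ (v j) (z i) = 0)
    (hz : ∀ i, ‖z i‖ ≤ 2) (hδ0 : 0 < δ) (hδ1 : δ < 1) (ht0 : 0 ≤ t) (ht1 : t ≤ 1)
    (hℓ : 0 ≤ ℓ) (hℓt : t * ℓ ^ 2 * d ≤ 1) {n : ℕ} (hn : (1 - δ)⁻¹ ^ n ≤ 1 + t) (hn0 : 1 ≤ n) :
    (volume : Measure (EuclideanSpace ℝ (Fin d))).real (noGap w v δ ∩ ball 0 1)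
      ≤ (Real.exp 4 / n + 4 * Fintype.card ι * Real.exp (-(d * ℓ ^ 2 / 2))) *
        (volume : Measure (EuclideanSpace ℝ (Fin d))).real (ball 0 1) := by
  classical
  set μ : Measure (EuclideanSpace ℝ (Fin d)) := volume
  obtain ⟨i₀⟩ := ‹Nonempty ι›
  have hsub : noGap w v δ ∩ ball 0 1 ⊆ (⋃ i, smallGapCore w v z δ ℓ i) ∪
      ((⋃ i, ball 0 1 ∩ {x | ℓ < |inner ℝ (v i) x|}) ∪
      ((⋃ i, ball 0 1 ∩ {x | ℓ < |inner ℝ ((1 / 2 : ℝ) • z i) x|}) ∪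
        (ball 0 1 ∩ {x | inner ℝ (v i₀) x = 0}))) := by
    rintro x ⟨hx, hxB⟩
    obtain ⟨i, -, hi⟩ := Finset.exists_max_image Finset.univ (fun j => w j * |inner ℝ (v j) x|)
      ⟨i₀, Finset.mem_univ _⟩
    have hi : ∀ j, w j * |inner ℝ (v j) x| ≤ w i * |inner ℝ (v i) x| := fun j =>
      hi j (Finset.mem_univ j)
    by_cases h0 : inner ℝ (v i) x = 0
    · refine Or.inr (Or.inr (Or.inr ⟨hxB, ?_⟩))
      have := hi i₀
      rw [h0, abs_zero, mul_zero] at this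
      have h1 : |inner ℝ (v i₀) x| ≤ 0 := by
        by_contra hc
        push Not at hc
        exact absurd this (not_le.2 (mul_pos (hw i₀) hc))
      exact abs_nonpos_iff.1 h1
    by_cases h1 : ℓ < |inner ℝ (v i) x|
    · exact Or.inr (Or.inl (Set.mem_iUnion.2 ⟨i, hxB, h1⟩))
    -- Halving `z i` brings its norm below one, as the cap bound requires.
    by_cases h2 : ℓ < |inner ℝ ((1 / 2 : ℝ) • z i) x|
    · exact Or.inr (Or.inr (Or.inl (Set.mem_iUnion.2 ⟨i, hxB, h2⟩)))
    refine Or.inl (Set.mem_iUnion.2 ⟨i, ⟨h0, hi, ?_⟩, hxB, not_lt.1 h1, ?_⟩)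
    · by_contra hc
      push Not at hc
      exact hx ⟨i, h0, hc⟩
    · rw [real_inner_smul_left, abs_mul, abs_of_pos (by norm_num)] at h2
      change |inner ℝ (z i) x| ≤ 2 * ℓ
      linarith
  have hfinB : ∀ s : Set (EuclideanSpace ℝ (Fin d)), s ⊆ ball 0 1 → μ s ≠ ⊤ := fun s hs =>
    ((measure_mono hs).trans_lt measure_ball_lt_top).ne
  have hn' : (0 : ℝ) < n := by exact_mod_cast hn0
  have hexp := Real.exp_pos (-(d * ℓ ^ 2 / 2))
  have hμB : 0 ≤ μ.real (ball 0 1) := measureReal_nonneg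
  have hcore : μ.real (⋃ i, smallGapCore w v z δ ℓ i) ≤ Real.exp 4 / n * μ.real (ball 0 1) := by
    have hdis : Pairwise fun i j => Disjoint (argmaxCone w v i ∩ ball 0 1)
        (argmaxCone w v j ∩ ball 0 1) := by
      intro i j hij
      rw [Set.disjoint_left]
      rintro x ⟨hx, -⟩ ⟨hx', -⟩
      exact lt_asymm (hx j hij.symm) (hx' i hij)
    calc μ.real (⋃ i, smallGapCore w v z δ ℓ i) ≤ ∑ i, μ.real (smallGapCore w v z δ ℓ i) :=
          measureReal_iUnion_fintype_le _
      _ ≤ ∑ i, Real.exp 4 / n * μ.real (argmaxCone w v i ∩ ball 0 1) := by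
          refine Finset.sum_le_sum fun i _ => ?_
          rw [div_mul_eq_mul_div, le_div_iff₀ hn', mul_comm]
          exact card_mul_volume_smallGapCore_le hd hw hvz hvz' hz hδ0 hδ1 ht0 ht1 hℓ hℓt hn i
      _ = Real.exp 4 / n * μ.real (⋃ i, argmaxCone w v i ∩ ball 0 1) := by
          rw [← Finset.mul_sum, measureReal_iUnion_fintype hdis
            (fun i => (measurableSet_argmaxCone i).inter measurableSet_ball)
            (fun i => hfinB _ Set.inter_subset_right)]
      _ ≤ _ := by
          refine mul_le_mul_of_nonneg_left ?_ (by positivity)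
          exact measureReal_mono (Set.iUnion_subset fun i => Set.inter_subset_right)
            (hfinB _ subset_rfl)
  have htail : ∀ y : ι → EuclideanSpace ℝ (Fin d), (∀ i, ‖y i‖ ≤ 1) →
      μ.real (⋃ i, ball 0 1 ∩ {x | ℓ < |inner ℝ (y i) x|})
        ≤ 2 * Fintype.card ι * Real.exp (-(d * ℓ ^ 2 / 2)) * μ.real (ball 0 1) := by
    intro y hy
    refine (measureReal_iUnion_fintype_le _).trans
      ((Finset.sum_le_sum fun i _ => volume_abs_cap_le (hy i) hℓ).trans (le_of_eq ?_))
    rw [Finset.sum_const, nsmul_eq_mul, Finset.card_univ]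
    ring
  have hnull : μ.real (ball 0 1 ∩ {x | inner ℝ (v i₀) x = 0}) = 0 := by
    have h1 : μ {x | inner ℝ (v i₀) x = 0} = 0 := by
      have := Measure.addHaar_submodule μ (LinearMap.ker (innerₛₗ ℝ (v i₀))) (by
        intro htop
        have : z i₀ ∈ LinearMap.ker (innerₛₗ ℝ (v i₀)) := htop ▸ Submodule.mem_top
        rw [LinearMap.mem_ker] at this
        have h2 := hvz i₀
        simp only [innerₛₗ_apply_apply] at this
        rw [this] at h2
        exact zero_ne_one h2)
      convert this using 2
      ext x
      simp [LinearMap.mem_ker]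
    rw [measureReal_def, measure_mono_null Set.inter_subset_right h1, ENNReal.toReal_zero]
  have h1 := htail v hv
  have h2 := htail (fun i => (1 / 2 : ℝ) • z i) fun i => by
    rw [norm_smul, Real.norm_eq_abs, abs_of_pos (by norm_num)]
    linarith [hz i]
  refine (measureReal_mono hsub (hfinB _ ?_)).trans ?_
  · refine Set.union_subset (Set.iUnion_subset fun i => ?_) (Set.union_subset
      (Set.iUnion_subset fun i => Set.inter_subset_left) (Set.union_subset
      (Set.iUnion_subset fun i => Set.inter_subset_left) Set.inter_subset_left))
    exact fun x hx => hx.2.1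
  · refine (measureReal_union_le _ _).trans ?_
    have h3 := measureReal_union_le (μ := μ) (⋃ i, ball 0 1 ∩ {x | ℓ < |inner ℝ (v i) x|})
      ((⋃ i, ball 0 1 ∩ {x | ℓ < |inner ℝ ((1 / 2 : ℝ) • z i) x|}) ∪
        (ball 0 1 ∩ {x | inner ℝ (v i₀) x = 0}))
    have h4 := measureReal_union_le (μ := μ)
      (⋃ i, ball 0 1 ∩ {x | ℓ < |inner ℝ ((1 / 2 : ℝ) • z i) x|})
      (ball 0 1 ∩ {x | inner ℝ (v i₀) x = 0})
    linarith

/-- The uniform distribution on the sphere, evaluated at a cone. -/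
theorem uniformSphere_le_of_cone (hd : 1 ≤ d) {Z : Set (EuclideanSpace ℝ (Fin d))}
    (hZ : MeasurableSet Z) (hcone : ∀ c : ℝ, 0 < c → ∀ x ∈ Z, c • x ∈ Z) {p : ℝ}
    (hp : (volume : Measure (EuclideanSpace ℝ (Fin d))).real (Z ∩ ball 0 1)
      ≤ p * (volume : Measure (EuclideanSpace ℝ (Fin d))).real (ball 0 1)) :
    uniformSphere d Z ≤ ENNReal.ofReal p := by
  set μ : Measure (EuclideanSpace ℝ (Fin d)) := volume
  have hZ' : MeasurableSet ((Subtype.val : sphere (0 : EuclideanSpace ℝ (Fin d)) 1 → _) ⁻¹' Z) :=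
    measurable_subtype_coe hZ
  have hBpos : μ (ball 0 1) ≠ 0 := (measure_ball_pos μ 0 one_pos).ne'
  have hBtop : μ (ball 0 1) ≠ ⊤ := measure_ball_lt_top.ne
  have hd0 : (d : ENNReal) ≠ 0 := by
    have : d ≠ 0 := by omega
    exact_mod_cast this
  -- Surface measure is `d` times the volume of the truncated cone over the set.
  have h1 : μ.toSphere (Subtype.val ⁻¹' Z) ≤ d * μ (Z ∩ ball 0 1) := by
    rw [Measure.toSphere_apply' _ hZ', finrank_euclideanSpace, Fintype.card_fin]
    gcongr
    rintro _ ⟨c, hc, _, ⟨y, hy, rfl⟩, rfl⟩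
    refine ⟨hcone c hc.1 _ hy, ?_⟩
    have hy1 : ‖(y : EuclideanSpace ℝ (Fin d))‖ = 1 := by simp
    rw [mem_ball_zero_iff]
    change ‖c • (y : EuclideanSpace ℝ (Fin d))‖ < 1
    rw [norm_smul, hy1, mul_one, Real.norm_eq_abs, abs_of_pos hc.1]
    exact hc.2
  have h2 : μ (Z ∩ ball 0 1) ≤ ENNReal.ofReal p * μ (ball 0 1) := by
    have hfin : μ (Z ∩ ball 0 1) ≠ ⊤ :=
      ((measure_mono Set.inter_subset_right).trans_lt measure_ball_lt_top).ne
    have hp0 : 0 ≤ p := by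
      by_contra hc
      push Not at hc
      have h3 : 0 < μ.real (ball 0 1) := ENNReal.toReal_pos hBpos hBtop
      have h4 : 0 ≤ μ.real (Z ∩ ball 0 1) := measureReal_nonneg
      nlinarith
    rw [← ENNReal.ofReal_toReal hfin, ← ENNReal.ofReal_toReal hBtop, ← ENNReal.ofReal_mul hp0]
    exact ENNReal.ofReal_le_ofReal hp
  rw [uniformSphere, Measure.smul_apply, Measure.map_apply measurable_subtype_coe hZ, smul_eq_mul,
    Measure.toSphere_apply_univ, finrank_euclideanSpace, Fintype.card_fin]
  have h5 : (d : ENNReal) * μ (ball 0 1) ≠ 0 := mul_ne_zero hd0 hBpos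
  have h6 : (d : ENNReal) * μ (ball 0 1) ≠ ⊤ := ENNReal.mul_ne_top (by simp) hBtop
  rw [mul_comm, ← div_eq_mul_inv]
  refine ENNReal.div_le_of_le_mul (h1.trans ?_)
  calc (d : ENNReal) * μ (Z ∩ ball 0 1) ≤ d * (ENNReal.ofReal p * μ (ball 0 1)) := by gcongr
    _ = _ := by ring

theorem isProbabilityMeasure_uniformSphere (hd : 1 ≤ d) :
    IsProbabilityMeasure (uniformSphere d) := by
  have : Nonempty (Fin d) := ⟨⟨0, hd⟩⟩
  constructor
  rw [uniformSphere, Measure.smul_apply, Measure.map_apply measurable_subtype_coe .univ,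
    Set.preimage_univ, smul_eq_mul]
  exact ENNReal.inv_mul_cancel (by
    rw [Ne, Measure.measure_univ_eq_zero]; exact Measure.toSphere_ne_zero _) (measure_ne_top _ _)

end Anticoncentration

/-! ### The gap at a random start, one column after another. -/

section RandomStart

open InnerProductSpace

variable {d k : ℕ} {w : Fin k → ℝ} {A : Fin k → EuclideanSpace ℝ (Fin d)} {γ β δ ℓ t : ℝ}

theorem HasGap.smul {y : Fin k → ℝ} {c : ℝ} (hc : 0 < c) (h : HasGap w δ y) :
    HasGap w δ fun j => c * y j := by
  obtain ⟨i, hi, hj⟩ := h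
  refine ⟨i, mul_ne_zero hc.ne' hi, fun j hji => ?_⟩
  rw [abs_mul, abs_mul, abs_of_pos hc]
  nlinarith [hj j hji]

theorem measurableSet_hasGap {Ω : Type*} [MeasurableSpace Ω] {Y : Ω → Fin k → ℝ}
    (hY : ∀ j, Measurable fun x => Y x j) : MeasurableSet {x | HasGap w δ (Y x)} := by
  have : {x | HasGap w δ (Y x)} = ⋃ i, ({x | Y x i = 0}ᶜ ∩
      ⋂ j, {x | j ≠ i → w j * |Y x j| ≤ (1 - δ) * (w i * |Y x i|)}) := by
    ext x; simp [HasGap]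
  rw [this]
  refine MeasurableSet.iUnion fun i => (measurableSet_eq_fun (hY i) measurable_const).compl.inter
    (MeasurableSet.iInter fun j => ?_)
  by_cases hj : j = i
  · simp [hj]
  · simp only [ne_eq, hj, not_false_eq_true, forall_const]
    exact measurableSet_le ((hY j).abs.const_mul _) (((hY i).abs.const_mul _).const_mul _)

namespace NearFactors

variable {ι : Type*} [Fintype ι] {σ : ι → Fin k} {X : ι → EuclideanSpace ℝ (Fin d)}

/-- Vectors dual to the factors that are not near any estimate. -/
theorem exists_dual (hX : NearFactors w A β σ X) (h : Regular w A γ β) {i : Fin k}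
    (hi : ∀ l, i ≠ σ l) :
    ∃ z : EuclideanSpace ℝ (Fin d), ‖z‖ ≤ 2 ∧ inner ℝ (A i) z = 1 ∧
      (∀ j, j ≠ i → (∀ l, j ≠ σ l) → inner ℝ (A j) z = 0) ∧
      (Submodule.span ℝ (Set.range X))ᗮ.starProjection z = z := by
  classical
  have hβ := h.beta_pos
  -- The dual vector is the rescaled component of `A i` orthogonal to the other unrecovered factors
  -- and to the estimates. Because of the latter it survives the projection.
  set B : {j : Fin k // j ≠ i ∧ ∀ l, j ≠ σ l} ⊕ ι → EuclideanSpace ℝ (Fin d) :=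
    Sum.elim (fun j => A j) X with hB
  have hnorm : ∀ a, ‖B a‖ = 1 := by
    rintro (j | l)
    · exact h.norm_eq j
    · exact (hX.near l).1
  have hinner : ∀ a a', a ≠ a' → |inner ℝ (B a) (B a')| ≤ 2 * β := by
    rintro (j | l) (j' | l') hne
    · exact (h.coh j j' fun e => hne (by rw [Subtype.ext e])).trans (by linarith)
    · exact hX.abs_inner_factor_le h (j.2.2 l')
    · change |inner ℝ (X l) (A j')| ≤ _
      rw [real_inner_comm]
      exact hX.abs_inner_factor_le h (j'.2.2 l)
    · exact hX.abs_inner_le h fun e => hne (by rw [e])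
  have hcard : (Fintype.card ({j : Fin k // j ≠ i ∧ ∀ l, j ≠ σ l} ⊕ ι) : ℝ) ≤ 2 * k := by
    rw [Fintype.card_sum]
    push_cast
    have h1 := Fintype.card_subtype_le fun j : Fin k => j ≠ i ∧ ∀ l, j ≠ σ l
    rw [Fintype.card_fin] at h1
    have h2 := hX.card_le
    have h3 : (Fintype.card {j : Fin k // j ≠ i ∧ ∀ l, j ≠ σ l} : ℝ) ≤ k := by exact_mod_cast h1
    linarith
  have hkβ := h.card_mul_le
  have hcardβ : (Fintype.card ({j : Fin k // j ≠ i ∧ ∀ l, j ≠ σ l} ⊕ ι) : ℝ) * (2 * β)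
      ≤ 1 / 2 := by
    have := mul_le_mul_of_nonneg_right hcard (by linarith : 0 ≤ 2 * β)
    linarith
  set W := Submodule.span ℝ (Set.range B) with hW
  have hproj : ‖W.starProjection (A i)‖ ^ 2 ≤ 1 / 2 := by
    have h1 := norm_sq_proj_le (v := A i) hnorm hinner (by linarith) hcardβ (by
      rintro (j | l)
      · exact (h.coh i j j.2.1.symm).trans (by linarith)
      · exact hX.abs_inner_factor_le h (hi l))
    refine h1.trans ?_
    nlinarith [h.beta_le, h.one_le_card]
  set z₀ := Wᗮ.starProjection (A i) with hz₀
  have hz₀W : z₀ ∈ Wᗮ := Submodule.starProjection_apply_mem _ _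
  have hsq := Submodule.norm_sq_eq_add_norm_sq_starProjection (A i) W
  rw [h.norm_eq] at hsq
  have hz₀sq : 1 / 2 ≤ ‖z₀‖ ^ 2 := by rw [hz₀]; linarith
  have hz₀pos : 0 < ‖z₀‖ ^ 2 := by linarith
  have horth : ∀ a, inner ℝ (B a) z₀ = 0 := fun a =>
    (Submodule.mem_orthogonal W z₀).1 hz₀W _ (Submodule.subset_span ⟨a, rfl⟩)
  refine ⟨(‖z₀‖ ^ 2)⁻¹ • z₀, ?_, ?_, ?_, ?_⟩
  · rw [norm_smul, Real.norm_eq_abs, abs_of_pos (by positivity)]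
    have hz₀1 : 0 < ‖z₀‖ := by
      by_contra hc
      have : ‖z₀‖ = 0 := le_antisymm (not_lt.1 hc) (norm_nonneg _)
      rw [this] at hz₀sq
      norm_num at hz₀sq
    rw [inv_mul_le_iff₀ hz₀pos]
    nlinarith
  · have h1 : Wᗮ.starProjection z₀ = z₀ := Submodule.starProjection_eq_self_iff.2 hz₀W
    have h2 : inner ℝ (A i) z₀ = ‖z₀‖ ^ 2 := by
      rw [← h1, ← Submodule.inner_starProjection_left_eq_right, ← hz₀, h1,
        real_inner_self_eq_norm_sq]
    rw [real_inner_smul_right, h2, inv_mul_cancel₀ hz₀pos.ne']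
  · intro j hj hjσ
    have h1 : inner ℝ (A j) z₀ = 0 := horth (Sum.inl ⟨j, hj, hjσ⟩)
    rw [real_inner_smul_right, h1, mul_zero]
  · refine Submodule.starProjection_eq_self_iff.2 (Submodule.smul_mem _ _ ?_)
    rw [Submodule.mem_orthogonal]
    intro x hx
    refine (Submodule.mem_orthogonal W z₀).1 hz₀W _ (Submodule.span_mono ?_ hx)
    rintro _ ⟨l, rfl⟩
    exact ⟨Sum.inr l, rfl⟩

/-- A random vector, projected to the orthogonal complement of the estimates, has a gap with high
probability. -/
theorem uniformSphere_not_hasGap_le (hX : NearFactors w A β σ X) (h : Regular w A γ β) (hd : 1 ≤ d)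
    (hι : Fintype.card ι < k) (hδ0 : 0 < δ) (hδ1 : δ ≤ 1 / 2) (ht0 : 0 ≤ t) (ht1 : t ≤ 1)
    (hℓ : 0 ≤ ℓ) (hℓt : t * ℓ ^ 2 * d ≤ 1) {n : ℕ} (hn : (1 - δ)⁻¹ ^ n ≤ 1 + t) (hn0 : 1 ≤ n) :
    uniformSphere d {x | ¬ HasGap w δ fun j =>
        inner ℝ (A j) ((Submodule.span ℝ (Set.range X))ᗮ.starProjection x)}
      ≤ ENNReal.ofReal (Real.exp 4 / n + 4 * k * Real.exp (-(d * ℓ ^ 2 / 2))) := by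
  classical
  set P := (Submodule.span ℝ (Set.range X))ᗮ.starProjection with hP
  have hmeas : MeasurableSet {x | HasGap w δ fun j => inner ℝ (A j) (P x)} :=
    measurableSet_hasGap fun j => by fun_prop
  refine uniformSphere_le_of_cone hd hmeas.compl (fun c hc x hx hx' => hx ?_) ?_
  · have := HasGap.smul (inv_pos.2 hc) hx'
    simpa [real_inner_smul_right, hc.ne'] using this
  -- Only unrecovered factors compete; the projected recovered ones may nearly vanish and have no
  -- bounded dual vectors.
  set S := {i : Fin k // ∀ l, i ≠ σ l}
  have hne : Nonempty S := by
    by_contra hc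
    have hsurj : Function.Surjective σ := by
      intro i
      by_contra hi
      push Not at hi
      exact hc ⟨⟨i, fun l e => hi l e.symm⟩⟩
    have := Fintype.card_le_of_surjective σ hsurj
    rw [Fintype.card_fin] at this
    omega
  have hdual := fun i : S => hX.exists_dual h i.2
  choose z hz hz1 hz0 hPz using hdual
  have hsymm : ∀ x y, inner ℝ (P x) y = inner ℝ x (P y) := fun x y =>
    Submodule.inner_starProjection_left_eq_right _ x y
  have hvol := volume_noGap_le (w := fun i : S => w i) (v := fun i : S => P (A i)) (z := z) hd
    (fun i => h.pos i)
    (fun i => (Submodule.norm_starProjection_apply_le _ _).trans_eq (h.norm_eq i))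
    (fun i => by rw [hsymm, hPz, hz1])
    (fun i j hji => by rw [hsymm, hPz, hz0 i j (fun e => hji (Subtype.ext e)) j.2])
    hz hδ0 (by linarith) ht0 ht1 hℓ hℓt hn hn0
  have hcard : (Fintype.card S : ℝ) ≤ k := by
    have := Fintype.card_subtype_le fun i : Fin k => ∀ l, i ≠ σ l
    rw [Fintype.card_fin] at this
    exact_mod_cast this
  have hexp := Real.exp_pos (-(d * ℓ ^ 2 / 2))
  refine (measureReal_mono ?_ ((measure_mono Set.inter_subset_right).trans_lt
    measure_ball_lt_top).ne).trans (hvol.trans (mul_le_mul_of_nonneg_right ?_ measureReal_nonneg))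
  · refine Set.inter_subset_inter_left _ fun x hx hgap => hx ?_
    obtain ⟨i, hi0, hi⟩ := hgap
    simp only [hsymm] at hi0 hi
    have hwi := h.pos i
    set M := w i * |inner ℝ (A i) (P x)| with hM
    have hMpos : 0 < M := mul_pos hwi (abs_pos.2 hi0)
    have hrec : ∀ l, ∀ M', (∀ j, w j * |inner ℝ (A j) (P x)| ≤ M') →
        w (σ l) * |inner ℝ (A (σ l)) (P x)| ≤ M' / 2 := fun l M' hM' =>
      (hX.near l).weighted_inner_le h ((Submodule.mem_orthogonal (Submodule.span ℝ (Set.range X)) _).1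
        (Submodule.starProjection_apply_mem _ x) (X l) (Submodule.subset_span ⟨l, rfl⟩)) hM'
    -- The maximum over all factors cannot be at a recovered one, so it is the maximum `M` over `S`.
    have hall : ∀ j, w j * |inner ℝ (A j) (P x)| ≤ M := by
      obtain ⟨j₀, -, hj₀⟩ := Finset.exists_max_image Finset.univ
        (fun j => w j * |inner ℝ (A j) (P x)|) ⟨i, Finset.mem_univ _⟩
      have hj₀ : ∀ j, w j * |inner ℝ (A j) (P x)| ≤ w j₀ * |inner ℝ (A j₀) (P x)| :=
        fun j => hj₀ j (Finset.mem_univ j)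
      have hjS : ∀ l, j₀ ≠ σ l := by
        rintro l rfl
        have h1 := hrec l _ hj₀
        have h2 := hj₀ i
        linarith
      intro j
      refine (hj₀ j).trans ?_
      by_cases hji : j₀ = i
      · rw [hji]
      · have := hi ⟨j₀, hjS⟩ fun e => hji (congrArg Subtype.val e)
        change w j₀ * |inner ℝ (A j₀) (P x)| ≤ (1 - δ) * M at this
        nlinarith
    refine ⟨i, hi0, fun j hji => ?_⟩
    by_cases hj : ∀ l, j ≠ σ l
    · exact hi ⟨j, hj⟩ fun e => hji (congrArg Subtype.val e)
    · push Not at hj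
      obtain ⟨l, rfl⟩ := hj
      -- Recovered factors reach at most `M / 2 ≤ (1 - δ) M`; this is where `δ ≤ 1/2` enters.
      have := hrec l M hall
      nlinarith
  · have : 4 * (Fintype.card S : ℝ) * Real.exp (-(d * ℓ ^ 2 / 2))
        ≤ 4 * k * Real.exp (-(d * ℓ ^ 2 / 2)) :=
      mul_le_mul_of_nonneg_right (by linarith) hexp.le
    linarith

end NearFactors

theorem gramSchmidt_congr {f g : Fin k → EuclideanSpace ℝ (Fin d)} {m : Fin k}
    (h : ∀ l, l ≤ m → f l = g l) : gramSchmidt ℝ f m = gramSchmidt ℝ g m := by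
  have hfg : (fun l : {l // l < m} => f l) = fun l : {l // l < m} => g l :=
    funext fun l => h l l.2.le
  rw [gramSchmidt_eq_starProjection, gramSchmidt_eq_starProjection, h m le_rfl]
  simp only [hfg]

/-- Information flows only from earlier to later columns. -/
theorem orthALS_congr (T : Tensor3 d) (N : ℕ) {u u' : Fin k → EuclideanSpace ℝ (Fin d)}
    {m : Fin k} (h : ∀ l, l ≤ m → u l = u' l) (s : ℕ) :
    ∀ l, l ≤ m → orthALS T N u s l = orthALS T N u' s l := by
  induction s with
  | zero => exact h
  | succ s ih =>
    intro l hl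
    simp only [orthALS]
    rw [h l hl, gramSchmidtNormed, gramSchmidtNormed,
      gramSchmidt_congr fun l' hl' => ih l' (hl'.trans hl)]

theorem startCorr_congr {N : ℕ} {u u' : Fin k → EuclideanSpace ℝ (Fin d)} {m : Fin k}
    (h : ∀ l, l ≤ m → u l = u' l) : startCorr w A N u m = startCorr w A N u' m := by
  ext j
  rw [startCorr, startCorr, corr, corr, gramSchmidt_congr (orthALS_congr _ _ h _)]

/-- Resampling column `m` leaves the earlier columns alone. With the other initial vectors fixed,
its start is thus a fixed projection of a uniform vector. -/
theorem startCorr_update {N : ℕ} (u : Fin k → EuclideanSpace ℝ (Fin d)) (m : Fin k)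
    (x : EuclideanSpace ℝ (Fin d)) :
    startCorr w A N (Function.update u m x) m = fun j => inner ℝ (A j)
      ((Submodule.span ℝ (Set.range fun l : {l // l < m} =>
        orthALS (Tensor3.ofFactors w A) N u (m * N) l))ᗮ.starProjection x) := by
  ext j
  have h1 : (fun l : {l // l < m} =>
      orthALS (Tensor3.ofFactors w A) N (Function.update u m x) (m * N) l)
      = fun l : {l // l < m} => orthALS (Tensor3.ofFactors w A) N u (m * N) l := by
    funext l
    refine orthALS_congr _ _ (m := l) (fun l' hl' => ?_) _ _ le_rfl
    exact Function.update_of_ne (hl'.trans_lt l.2).ne _ _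
  rw [startCorr, corr, gramSchmidt_eq_starProjection, orthALS_start, Function.update_self]
  simp only [h1]

theorem measurable_gramSchmidt {Ω : Type*} [MeasurableSpace Ω]
    {F : Ω → Fin k → EuclideanSpace ℝ (Fin d)} (hF : ∀ l, Measurable fun x => F x l) (m : Fin k) :
    Measurable fun x => gramSchmidt ℝ (F x) m := by
  induction m using WellFoundedLT.induction with
  | ind m ih =>
    simp only [gramSchmidt_def ℝ _ m, Submodule.starProjection_singleton]
    refine (hF m).sub (Finset.measurable_sum _ fun l hl => ?_)
    have h1 := ih l (Finset.mem_Iio.1 hl)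
    have h2 := hF m
    exact ((h1.inner h2).div (h1.norm.pow_const 2)).smul h1

theorem measurable_orthALS (w : Fin k → ℝ) (A : Fin k → EuclideanSpace ℝ (Fin d)) (N s : ℕ)
    (m : Fin k) : Measurable fun u => orthALS (Tensor3.ofFactors w A) N u s m := by
  induction s generalizing m with
  | zero => exact measurable_pi_apply m
  | succ s ih =>
    by_cases h : (m : ℕ) * N ≤ s
    · simp only [orthALS_succ _ _ _ h, powerUpdate, Tensor3.contract_ofFactors]
      have h1 : Measurable fun u =>
          gramSchmidtNormed ℝ (orthALS (Tensor3.ofFactors w A) N u s) m := by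
        have := measurable_gramSchmidt ih m
        unfold gramSchmidtNormed
        exact (this.norm.inv).smul this
      fun_prop
    · simp only [orthALS, if_neg h]
      exact measurable_pi_apply m

theorem measurable_startCorr (w : Fin k → ℝ) (A : Fin k → EuclideanSpace ℝ (Fin d)) (N : ℕ)
    (m j : Fin k) : Measurable fun u => startCorr w A N u m j := by
  have := measurable_gramSchmidt (fun l => measurable_orthALS w A N (m * N) l) m
  unfold startCorr corr
  fun_prop

/-- A set is small in a product if all its sections in one coordinate direction are small. -/
theorem pi_le_of_section_le {ι : Type*} [Fintype ι] [DecidableEq ι] {Ω : ι → Type*}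
    [∀ i, MeasurableSpace (Ω i)] (μ : ∀ i, Measure (Ω i)) [∀ i, IsProbabilityMeasure (μ i)]
    {S : Set (∀ i, Ω i)} (hS : MeasurableSet S) (m : ι) {p : ENNReal}
    (h : ∀ u, μ m {x | Function.update u m x ∈ S} ≤ p) : Measure.pi μ S ≤ p := by
  have h1 : ∫⁻ u, S.indicator 1 u ∂Measure.pi μ ≤ ∫⁻ _u, p ∂Measure.pi μ := by
    refine lintegral_le_of_lmarginal_le {m} (measurable_const.indicator hS) measurable_const ?_
    intro u
    rw [lmarginal_singleton, lmarginal_singleton]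
    have h2 : ∀ x, S.indicator (1 : (∀ i, Ω i) → ENNReal) (Function.update u m x)
        = {x | Function.update u m x ∈ S}.indicator 1 x := fun x => rfl
    simp only [h2]
    have h3 : MeasurableSet {x | Function.update u m x ∈ S} := measurable_update u hS
    rw [lintegral_indicator_one h3]
    simpa using h u
  rw [lintegral_indicator_one hS] at h1
  simpa using h1

/-- With high probability every estimate starts with a gap. -/
theorem pi_exists_not_hasGap_le (h : Regular w A γ β) (hd : 1 ≤ d) (hδ : 32 * (k * γ * β) ≤ δ)
    (hδ0 : 0 < δ) (hδ1 : δ ≤ 1 / 2) {s₁ s₂ : ℕ} (hs₁ : 1 / 2 ≤ δ * (13 / 10) ^ s₁)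
    (hs₂ : γ * quadRate s₂ ≤ β) {N : ℕ} (hN : s₁ + 3 + s₂ + s₂ ≤ N)
    (ht0 : 0 ≤ t) (ht1 : t ≤ 1) (hℓ : 0 ≤ ℓ) (hℓt : t * ℓ ^ 2 * d ≤ 1) {n : ℕ}
    (hn : (1 - δ)⁻¹ ^ n ≤ 1 + t) (hn0 : 1 ≤ n) :
    Measure.pi (fun _ : Fin k => uniformSphere d)
        {u | ∃ m, ¬ HasGap w δ (startCorr w A N u m)}
      ≤ k * ENNReal.ofReal (Real.exp 4 / n + 4 * k * Real.exp (-(d * ℓ ^ 2 / 2))) := by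
  classical
  have hprob : IsProbabilityMeasure (uniformSphere d) := isProbabilityMeasure_uniformSphere hd
  set p := ENNReal.ofReal (Real.exp 4 / n + 4 * k * Real.exp (-(d * ℓ ^ 2 / 2)))
  have hG : ∀ m, MeasurableSet {u : Fin k → EuclideanSpace ℝ (Fin d) |
      HasGap w δ (startCorr w A N u m)} := fun m =>
    measurableSet_hasGap fun j => measurable_startCorr w A N m j
  -- Column `m` is the first one without a gap. The condition on earlier columns does not involve `u
  -- m`, so on each section it holds everywhere or nowhere.
  set bad : Fin k → Set (Fin k → EuclideanSpace ℝ (Fin d)) := fun m =>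
    (⋂ l : {l // l < m}, {u | HasGap w δ (startCorr w A N u l)}) ∩
      {u | HasGap w δ (startCorr w A N u m)}ᶜ with hbad
  have hbadm : ∀ m, MeasurableSet (bad m) := fun m =>
    (MeasurableSet.iInter fun l : {l // l < m} => hG l).inter (hG m).compl
  have hsub : {u | ∃ m, ¬ HasGap w δ (startCorr w A N u m)} ⊆ ⋃ m, bad m := by
    rintro u ⟨m, hm⟩
    obtain ⟨m₀, hm₀, hmin⟩ := WellFounded.has_min (wellFounded_lt (α := Fin k))
      {m | ¬ HasGap w δ (startCorr w A N u m)} ⟨m, hm⟩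
    refine Set.mem_iUnion.2 ⟨m₀, Set.mem_iInter.2 fun l => ?_, hm₀⟩
    by_contra hc
    exact hmin l hc l.2
  have hle : ∀ m, Measure.pi (fun _ : Fin k => uniformSphere d) (bad m) ≤ p := by
    intro m
    refine pi_le_of_section_le _ (hbadm m) m fun u => ?_
    by_cases hu : ∀ l : Fin k, (l : ℕ) < m → HasGap w δ (startCorr w A N u l)
    · obtain ⟨σ, hσ, hnear⟩ := exists_nearFactors_of_hasGap h hδ hδ0 hs₁ hs₂ hN (m : ℕ) m.2.le hu
      have hX : NearFactors w A β (fun l : {l // l < m} => σ l)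
          fun l : {l // l < m} => orthALS (Tensor3.ofFactors w A) N u (m * N) l := by
        refine ⟨fun l => ?_, fun l l' hll => Subtype.ext (hσ l l' l.2 l'.2 hll)⟩
        have hl : ((l : Fin k) : ℕ) < m := l.2
        have h1 : ((l : Fin k) : ℕ) * N + N ≤ m * N := by
          rw [← Nat.succ_mul]; exact Nat.mul_le_mul_right _ hl
        have := hnear l hl (m * N - (l : Fin k) * N) (by omega)
        rwa [Nat.add_sub_cancel' (by omega)] at this
      have hcard : Fintype.card {l // l < m} < k := by
        have := Fintype.card_subtype_lt (p := fun l : Fin k => l < m) (x := m) (lt_irrefl m)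
        rwa [Fintype.card_fin] at this
      refine (measure_mono ?_).trans
        (hX.uniformSphere_not_hasGap_le h hd hcard hδ0 hδ1 ht0 ht1 hℓ hℓt hn hn0)
      rintro x ⟨-, hx⟩ hx'
      refine hx ?_
      change HasGap w δ (startCorr w A N (Function.update u m x) m)
      rwa [startCorr_update]
    · have : {x | Function.update u m x ∈ bad m} = ∅ := by
        rw [Set.eq_empty_iff_forall_notMem]
        rintro x ⟨hx, -⟩
        refine hu fun l hl => ?_
        have h1 := Set.mem_iInter.1 hx ⟨l, hl⟩
        change HasGap w δ (startCorr w A N (Function.update u m x) l) at h1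
        rwa [startCorr_congr (u' := u) fun l' hl' =>
          Function.update_of_ne (hl'.trans_lt (show l < m from hl)).ne _ _] at h1
      rw [this, measure_empty]
      exact zero_le
  calc _ ≤ Measure.pi (fun _ : Fin k => uniformSphere d) (⋃ m, bad m) := measure_mono hsub
    _ ≤ ∑ m, Measure.pi (fun _ : Fin k => uniformSphere d) (bad m) :=
        measure_iUnion_fintype_le _ _
    _ ≤ ∑ _m : Fin k, p := Finset.sum_le_sum fun m _ => hle m
    _ = k * p := by simp

end RandomStart

/-! ### Accuracy of the recovered weights, and estimates for the constants. -/

section Recovery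

variable {d k : ℕ} {w : Fin k → ℝ} {A : Fin k → EuclideanSpace ℝ (Fin d)} {γ β : ℝ}

/-- The cube of the main correlation is within `3β/100` of 1, and the cubes of the others add at
most `8kγβ³ ≤ β`. -/
theorem NearFactor.abs_one_sub_weight_le {i : Fin k} {X : EuclideanSpace ℝ (Fin d)}
    (hX : NearFactor w A β i X) (h : Regular w A γ β) :
    |1 - (Tensor3.ofFactors w A).weightEstimate X / w i| ≤ 2 * β := by
  have hwi := h.pos i
  have hβ := h.beta_pos
  have herr := hX.norm_sub_le h
  have herr' := NearFactors.error_le h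
  -- A one-element family gives access to `abs_inner_factor_le`.
  have hX' : NearFactors w A β (fun _ : Unit => i) (fun _ => X) :=
    ⟨fun _ => hX, Function.injective_of_subsingleton _⟩
  set a : Fin k → ℝ := fun j => inner ℝ (A j) X with ha
  have hai : |1 - a i| ≤ β / 100 := by
    have h1 : 1 - a i = inner ℝ (A i) (A i - X) := by
      rw [inner_sub_right, real_inner_self_eq_norm_sq, h.norm_eq]; simp [ha]
    have h2 := abs_real_inner_le_norm (A i) (A i - X)
    rw [h.norm_eq, one_mul] at h2
    rw [h1]; linarith
  have hai1 : |a i| ≤ 1 := by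
    have := abs_real_inner_le_norm (A i) X
    rwa [h.norm_eq, hX.1, one_mul] at this
  have haj : ∀ j, j ≠ i → |a j| ≤ 2 * β := fun j hj => hX'.abs_inner_factor_le h (l := ()) hj
  have hsum : |∑ j ∈ Finset.univ.erase i, w j / w i * a j ^ 3| ≤ β := by
    have h1 : ∀ j ∈ Finset.univ.erase i, |w j / w i * a j ^ 3| ≤ γ * (2 * β) ^ 3 := by
      intro j hj
      have hwj := h.pos j
      rw [abs_mul, abs_pow, abs_of_pos (by positivity)]
      have h2 : w j / w i ≤ γ := by rw [div_le_iff₀ hwi]; exact h.ratio j i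
      exact mul_le_mul h2 (pow_le_pow_left₀ (abs_nonneg _) (haj j (Finset.ne_of_mem_erase hj)) 3)
        (by positivity) (by linarith [h.one_le])
    refine (Finset.abs_sum_le_sum_abs _ _).trans ((Finset.sum_le_sum h1).trans ?_)
    rw [Finset.sum_const, nsmul_eq_mul]
    have h4 : ((Finset.univ.erase i).card : ℝ) ≤ k := by
      have := Finset.card_le_univ (Finset.univ.erase i)
      rw [Fintype.card_fin] at this
      exact_mod_cast this
    have hγ := h.one_le
    calc _ ≤ (k : ℝ) * (γ * (2 * β) ^ 3) := mul_le_mul_of_nonneg_right h4 (by positivity)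
      _ = (k * γ * β) * (8 * β ^ 2) := by ring
      _ ≤ 1 / 100000 * (8 * β ^ 2) :=
          mul_le_mul_of_nonneg_right h.card_mul_ratio_mul_le (by positivity)
      _ ≤ β := by nlinarith [h.beta_le]
  have hest : (Tensor3.ofFactors w A).weightEstimate X / w i
      = a i ^ 3 + ∑ j ∈ Finset.univ.erase i, w j / w i * a j ^ 3 := by
    rw [Tensor3.weightEstimate_ofFactors, Finset.sum_div,
      ← Finset.add_sum_erase _ _ (Finset.mem_univ i)]
    congr 1
    · field_simp; rfl
    · exact Finset.sum_congr rfl fun j _ => by simp only [ha]; ring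
  have hcube : |1 - a i ^ 3| ≤ 3 * (β / 100) := by
    have h1 : 1 - a i ^ 3 = (1 - a i) * (1 + a i + a i ^ 2) := by ring
    rw [h1, abs_mul, mul_comm]
    refine mul_le_mul ?_ hai (abs_nonneg _) (by norm_num)
    have h2 := abs_le.1 hai1
    rw [abs_le]
    constructor <;> nlinarith
  rw [hest, ← sub_sub]
  refine (abs_sub _ _).trans ?_
  linarith

theorem recoversAll_of_hasGap {δ : ℝ} (h : Regular w A (weightRatio w) β) (hβ : β ≤ eta A)
    (hδ : 32 * (k * weightRatio w * β) ≤ δ)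
    (hδ0 : 0 < δ) {s₁ s₂ : ℕ} (hs₁ : 1 / 2 ≤ δ * (13 / 10) ^ s₁)
    (hs₂ : weightRatio w * quadRate s₂ ≤ β)
    {N : ℕ} (hN : s₁ + 3 + s₂ + s₂ ≤ N) {C : ℝ} (hC : 162 ≤ C)
    (hstep : ((s₁ + 3 + s₂ + s₂ : ℕ) : ℝ) ≤ C * stepBound k d)
    {u : Fin k → EuclideanSpace ℝ (Fin d)}
    (hgap : ∀ m : Fin k, HasGap w δ (startCorr w A N u m)) : RecoversAll w A C N u := by
  obtain ⟨σ, hσ, hnear⟩ := exists_nearFactors_of_hasGap h hδ hδ0 hs₁ hs₂ hN (u := u) k le_rfl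
    fun m _ => hgap m
  have hinj : Function.Injective σ := fun l l' e => hσ l l' l.2 l'.2 e
  refine ⟨Equiv.ofBijective σ (Finite.injective_iff_bijective.1 hinj), fun m s hs => ?_⟩
  rw [Equiv.ofBijective_apply]
  have hn := hnear m m.2 s (by exact_mod_cast hstep.trans hs)
  have hβ0 := h.beta_pos
  constructor
  · refine (hn.norm_sub_le h).trans ?_
    have h1 : β ^ 2 ≤ eta A ^ 2 := pow_le_pow_left₀ hβ0.le hβ 2
    have h2 : 0 ≤ (k : ℝ) * weightRatio w := mul_nonneg (by positivity) (by linarith [h.one_le])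
    calc 162 * (k * weightRatio w * β ^ 2) ≤ 162 * (weightRatio w * k * eta A ^ 2) := by
          have := mul_le_mul_of_nonneg_left h1 h2
          linarith
      _ ≤ _ := mul_le_mul_of_nonneg_right hC (by
          rw [mul_comm (weightRatio w)]; exact mul_nonneg h2 (sq_nonneg _))
  · refine (hn.abs_one_sub_weight_le h).trans ?_
    nlinarith

theorem le_weightRatio_mul (hw : ∀ i, 0 < w i) (i j : Fin k) : w i ≤ weightRatio w * w j := by
  have : Nonempty (Fin k) := ⟨i⟩
  obtain ⟨j₀, hj₀⟩ := exists_eq_ciInf_of_finite (f := w)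
  have h1 : w i ≤ ⨆ i, w i := le_ciSup (Set.finite_range w).bddAbove i
  have h2 : (⨅ i, w i) ≤ w j := ciInf_le (Set.finite_range w).bddBelow j
  have h3 : 0 < ⨅ i, w i := hj₀ ▸ hw j₀
  rw [weightRatio, div_mul_eq_mul_div, le_div_iff₀ h3]
  have := hw i
  exact mul_le_mul h1 h2 h3.le (this.le.trans h1)

theorem abs_inner_le_incoherence (A : Fin k → EuclideanSpace ℝ (Fin d)) {i j : Fin k}
    (hij : i ≠ j) : |inner ℝ (A i) (A j)| ≤ incoherence A := by
  have h1 : (if i = j then 0 else |inner ℝ (A i) (A j)|)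
      ≤ ⨆ j, if i = j then 0 else |inner ℝ (A i) (A j)| :=
    le_ciSup (f := fun j => if i = j then 0 else |inner ℝ (A i) (A j)|)
      (Set.finite_range _).bddAbove j
  rw [if_neg hij] at h1
  exact h1.trans (le_ciSup (f := fun i => ⨆ j, if i = j then 0 else |inner ℝ (A i) (A j)|)
    (Set.finite_range _).bddAbove i)

theorem incoherence_nonneg (A : Fin k → EuclideanSpace ℝ (Fin d)) : 0 ≤ incoherence A :=
  Real.iSup_nonneg fun i => Real.iSup_nonneg fun j => by split_ifs <;> positivity

/-- Four amplifications gain at least a factor `e`, because `(13/10)⁴ ≥ e`. -/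
theorem gap_amplification_steps {Γ ε : ℝ} (hΓ : 0 < Γ) (hk : 1 ≤ k) {s : ℕ}
    (hs : 4 * ((1 + ε) * Real.log k + |Real.log (64 * Γ)|) ≤ s) :
    1 / 2 ≤ 32 * Γ * (k : ℝ) ^ (-(1 + ε)) * (13 / 10) ^ s := by
  have hk0 : (0 : ℝ) < k := by exact_mod_cast hk
  have h0 : Real.exp (1 / 4) ≤ 13 / 10 := by
    refine le_of_pow_le_pow_left₀ (n := 4) (by norm_num) (by norm_num) ?_
    rw [← Real.exp_nat_mul]
    have := Real.exp_one_lt_d9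
    norm_num at this ⊢
    linarith
  have h1 : Real.exp ((1 + ε) * Real.log k - Real.log (64 * Γ)) ≤ (13 / 10) ^ s := by
    calc _ ≤ Real.exp (s * (1 / 4)) := Real.exp_le_exp.2 (by
          linarith [neg_abs_le (Real.log (64 * Γ))])
      _ = Real.exp (1 / 4) ^ s := Real.exp_nat_mul _ _
      _ ≤ _ := pow_le_pow_left₀ (Real.exp_nonneg _) h0 s
  have h2 : Real.exp ((1 + ε) * Real.log k - Real.log (64 * Γ))
      = (k : ℝ) ^ (1 + ε) / (64 * Γ) := by
    rw [Real.exp_sub, Real.exp_log (by positivity), Real.rpow_def_of_pos hk0, mul_comm]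
  rw [h2] at h1
  calc (1 / 2 : ℝ) = 32 * Γ * (k : ℝ) ^ (-(1 + ε)) * ((k : ℝ) ^ (1 + ε) / (64 * Γ)) := by
        rw [Real.rpow_neg hk0.le]
        have : (0 : ℝ) < (k : ℝ) ^ (1 + ε) := Real.rpow_pos_of_pos hk0 _
        field_simp
        norm_num
    _ ≤ _ := mul_le_mul_of_nonneg_left h1 (by positivity)

/-- It suffices that `2^(2^s) ≥ Γ d^(K+1)`. The bound `exp(1/2) ≤ 2` is used once for each
exponential, and the two logarithms leave `log log d`. -/
theorem quadratic_convergence_steps {Γ γ Q : ℝ} (hΓ : 0 < Γ) (hd : 1 ≤ d) (hγ : γ ≤ Γ * d) {K : ℕ}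
    (hQ : 2 * (|Real.log Γ| + K + 1) ≤ Q) {s : ℕ}
    (hs : 2 * (Real.log Q + Real.log (1 + Real.log d)) ≤ s) :
    γ * quadRate s ≤ 1 / (d : ℝ) ^ K := by
  have hd0 : (0 : ℝ) < d := by exact_mod_cast hd
  have hlogd : 0 ≤ Real.log d := Real.log_nonneg (by exact_mod_cast hd)
  have habs := abs_nonneg (Real.log Γ)
  have hK : (0 : ℝ) ≤ K := by positivity
  have hQ0 : 0 < Q := by linarith
  have h2 : Real.exp (1 / 2) ≤ 2 := by
    refine le_of_pow_le_pow_left₀ (n := 2) (by norm_num) (by norm_num) ?_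
    rw [← Real.exp_nat_mul]
    have := Real.exp_one_lt_d9
    norm_num at this ⊢
    linarith
  have h3 : Q * (1 + Real.log d) ≤ (2 : ℝ) ^ s := by
    calc Q * (1 + Real.log d) = Real.exp (Real.log Q + Real.log (1 + Real.log d)) := by
          rw [Real.exp_add, Real.exp_log hQ0, Real.exp_log (by linarith)]
      _ ≤ Real.exp (s * (1 / 2)) := Real.exp_le_exp.2 (by linarith)
      _ = Real.exp (1 / 2) ^ s := Real.exp_nat_mul _ _
      _ ≤ _ := pow_le_pow_left₀ (Real.exp_nonneg _) h2 s
  have h4 : Real.log Γ + (K + 1) * Real.log d ≤ (2 : ℝ) ^ s * (1 / 2) := by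
    have h5 : 2 * (|Real.log Γ| + K + 1) * (1 + Real.log d) ≤ Q * (1 + Real.log d) :=
      mul_le_mul_of_nonneg_right hQ (by linarith)
    nlinarith [le_abs_self (Real.log Γ), mul_nonneg habs hlogd]
  have h5 : Γ * (d : ℝ) ^ (K + 1) ≤ (2 : ℝ) ^ (2 ^ s) := by
    calc Γ * (d : ℝ) ^ (K + 1) = Real.exp (Real.log Γ + (K + 1) * Real.log d) := by
          rw [Real.exp_add, Real.exp_log hΓ]
          congr 1
          have := Real.exp_nat_mul (Real.log d) (K + 1)
          rw [Real.exp_log hd0] at this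
          rw [← this]; push_cast; rfl
      _ ≤ Real.exp (((2 ^ s : ℕ) : ℝ) * (1 / 2)) := Real.exp_le_exp.2 (by push_cast; exact h4)
      _ = Real.exp (1 / 2) ^ (2 ^ s) := Real.exp_nat_mul _ _
      _ ≤ _ := pow_le_pow_left₀ (Real.exp_nonneg _) h2 _
  have h6 := quadRate_pos s
  rw [le_div_iff₀ (by positivity)]
  calc γ * quadRate s * (d : ℝ) ^ K ≤ Γ * d * quadRate s * (d : ℝ) ^ K := by gcongr
    _ = Γ * (d : ℝ) ^ (K + 1) * quadRate s := by ring
    _ ≤ (2 : ℝ) ^ (2 ^ s) * quadRate s := by gcongr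
    _ = 1 / 4 := by
        unfold quadRate
        rw [one_div_pow]
        field_simp
    _ ≤ 1 := by norm_num

/-- Bernoulli's inequality gives `(1 - δ)^n ≥ 1 - t/2`, and `1/(1 - t/2) ≤ 1 + t` for `t` in `[0,
1]`. -/
theorem inv_one_sub_pow_le {δ t : ℝ} (hδ0 : 0 < δ) (hδ : 2 * δ ≤ t) (ht1 : t ≤ 1) {n : ℕ}
    (hn : n * (2 * δ) ≤ t) : (1 - δ)⁻¹ ^ n ≤ 1 + t := by
  have h1 : 1 + (n : ℝ) * (-δ) ≤ (1 + -δ) ^ n := one_add_mul_le_pow (by linarith) n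
  have h2 : 1 - t / 2 ≤ (1 - δ) ^ n := by
    rw [← sub_eq_add_neg] at h1
    linarith
  have h3 : 0 < 1 - t / 2 := by linarith
  rw [inv_pow]
  calc ((1 - δ) ^ n)⁻¹ ≤ (1 - t / 2)⁻¹ := inv_anti₀ h3 h2
    _ ≤ 1 + t := by
        rw [inv_le_iff_one_le_mul₀ h3]
        nlinarith

/-- The total failure probability. -/
theorem failure_probability_le {Γ ε t δ L : ℝ} (hε : 0 < ε) (hk : 3 ≤ k) (hΓ : 0 < Γ)
    (hδ : δ = 32 * Γ * (k : ℝ) ^ (-(1 + ε))) (hL : L = 2 * (2 + ε) * Real.log k) (ht : t = 1 / L)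
    (hL0 : 0 < L) {n : ℕ} (hn : t ≤ 4 * δ * n) (hn0 : 1 ≤ n) :
    k * (Real.exp 4 / n + 4 * k * Real.exp (-(L / 2)))
      ≤ (256 * Real.exp 4 * Γ * (2 + ε) + 4) * (1 + Real.log k) * (k : ℝ) ^ (-ε) := by
  have hk0 : (0 : ℝ) < k := by exact_mod_cast (by omega : 0 < k)
  have hn' : (0 : ℝ) < n := by exact_mod_cast hn0
  have hlog : 0 ≤ Real.log k := Real.log_nonneg (by exact_mod_cast (by omega : 1 ≤ k))
  set P := (k : ℝ) ^ (-ε) with hP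
  have hP0 : 0 < P := Real.rpow_pos_of_pos hk0 _
  have h1 : (k : ℝ) * (k : ℝ) ^ (-(1 + ε)) = P := by
    rw [hP, ← Real.rpow_one_add' hk0.le (by linarith)]
    congr 1; ring
  -- The cut-off `L` is chosen so that `k²` tails, `k` for each of the `k` columns, still sum to
  -- `O(k^(-ε))`.
  have h2 : Real.exp (-(L / 2)) = (k : ℝ) ^ (-(2 + ε)) := by
    rw [Real.rpow_def_of_pos hk0, hL]; congr 1; ring
  have h3 : (k : ℝ) * (k * (k : ℝ) ^ (-(2 + ε))) = P := by
    rw [← h1]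
    congr 1
    rw [← Real.rpow_one_add' hk0.le (by linarith)]
    congr 1; ring
  -- Here `1/n ≤ 4δ/t = 4δL`, the fraction `O(δ log k)` of small-gap starts.
  have h4 : Real.exp 4 / n ≤ Real.exp 4 * (4 * δ * L) := by
    rw [div_le_iff₀ hn', mul_assoc]
    refine le_mul_of_one_le_right (Real.exp_nonneg _) ?_
    rw [ht, div_le_iff₀ hL0] at hn
    linarith
  have h5 : (k : ℝ) * (Real.exp 4 * (4 * δ * L))
      = 256 * Real.exp 4 * Γ * (2 + ε) * Real.log k * P := by
    rw [hδ, hL, ← h1]; ring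
  calc _ = k * (Real.exp 4 / n) + 4 * (k * (k * Real.exp (-(L / 2)))) := by ring
    _ ≤ k * (Real.exp 4 * (4 * δ * L)) + 4 * P := by
        rw [h2, h3]
        have := mul_le_mul_of_nonneg_left h4 hk0.le
        linarith
    _ ≤ _ := by
        rw [h5]
        have h6 : 0 < Real.exp 4 * Γ * (2 + ε) := by positivity
        have h7 := mul_nonneg hlog hP0.le
        have h8 := mul_pos h6 hP0
        nlinarith

end Recovery

/-! ### Choice of the parameters. -/

section Recovery

variable {d k : ℕ} {w : Fin k → ℝ} {A : Fin k → EuclideanSpace ℝ (Fin d)} {γ β : ℝ}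

/-- The hypotheses of the theorem give a regular family, for a coherence bound that is at least a
fixed power of `1 / d`. -/
theorem regular_of_incoherence_le {ε Γ : ℝ} (hε : 0 < ε) (hΓ : 0 < Γ) (hA : ∀ i, ‖A i‖ = 1)
    (hw : ∀ i, 0 < w i) (hk : 1 ≤ k) {K : ℕ} (hK : 3 + ε ≤ K)
    (hc : weightRatio w * incoherence A ≤ Γ * (k : ℝ) ^ (-(2 + ε)))
    (hγ : weightRatio w ≤ Γ * d) (hsmall : Γ * (k : ℝ) ^ (-ε) ≤ 1 / 100000) :
    Regular w A (weightRatio w) (max (incoherence A) (1 / (d : ℝ) ^ K)) ∧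
      weightRatio w * max (incoherence A) (1 / (d : ℝ) ^ K) ≤ Γ * (k : ℝ) ^ (-(2 + ε)) := by
  have hk0 : (0 : ℝ) < k := by exact_mod_cast hk
  have hk1 : (1 : ℝ) ≤ k := by exact_mod_cast hk
  have hratio := le_weightRatio_mul hw
  have hγ1 : 1 ≤ weightRatio w := by
    have := hratio ⟨0, hk⟩ ⟨0, hk⟩
    have := hw ⟨0, hk⟩
    by_contra hlt
    push Not at hlt
    nlinarith
  have hc0 := incoherence_nonneg A
  have hpow : (k : ℝ) ^ 2 * (k : ℝ) ^ (-(2 + ε)) = (k : ℝ) ^ (-ε) := by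
    rw [← Real.rpow_natCast, ← Real.rpow_add hk0]
    congr 1; push_cast; ring
  have hk2 : (k : ℝ) ^ 2 * (Γ * (k : ℝ) ^ (-(2 + ε))) ≤ 1 / 100000 := by
    calc _ = Γ * ((k : ℝ) ^ 2 * (k : ℝ) ^ (-(2 + ε))) := by ring
      _ ≤ _ := by rw [hpow]; exact hsmall
  have hkc : (k : ℝ) * incoherence A ≤ 1 / 2 := by
    have h1 : incoherence A ≤ weightRatio w * incoherence A := le_mul_of_one_le_left hc0 hγ1
    have h2 : (k : ℝ) ≤ k ^ 2 := by nlinarith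
    calc (k : ℝ) * incoherence A ≤ k ^ 2 * (Γ * (k : ℝ) ^ (-(2 + ε))) :=
          mul_le_mul h2 (h1.trans hc) hc0 (by positivity)
      _ ≤ _ := hk2.trans (by norm_num)
  -- Near orthogonality makes the factors independent, so `k ≤ d`. Then `γ d^(-K) ≤ Γ d^(1-K) ≤ Γ
  -- k^(-(2+ε))` because `K ≥ 3 + ε`.
  have hkd : k ≤ d := by
    have hli := linearIndependent_of_nearly_orthonormal hA
      (fun i j hij => abs_inner_le_incoherence A hij) hc0 (by rwa [Fintype.card_fin])
    have := hli.fintype_card_le_finrank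
    simpa using this
  have hd0 : (0 : ℝ) < d := by exact_mod_cast (lt_of_lt_of_le hk hkd)
  have hkd' : (k : ℝ) ≤ d := by exact_mod_cast hkd
  have hdK : weightRatio w * (1 / (d : ℝ) ^ K) ≤ Γ * (k : ℝ) ^ (-(2 + ε)) := by
    calc weightRatio w * (1 / (d : ℝ) ^ K) ≤ Γ * d * (1 / (d : ℝ) ^ K) := by gcongr
      _ = Γ * (d : ℝ) ^ (1 - (K : ℝ)) := by
          rw [Real.rpow_sub hd0, Real.rpow_one, Real.rpow_natCast]; ring
      _ ≤ Γ * (k : ℝ) ^ (1 - (K : ℝ)) := by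
          refine mul_le_mul_of_nonneg_left ?_ hΓ.le
          exact Real.rpow_le_rpow_of_nonpos hk0 hkd' (by linarith)
      _ ≤ _ := by
          refine mul_le_mul_of_nonneg_left ?_ hΓ.le
          exact Real.rpow_le_rpow_of_exponent_le hk1 (by linarith)
  have hγβ : weightRatio w * max (incoherence A) (1 / (d : ℝ) ^ K)
      ≤ Γ * (k : ℝ) ^ (-(2 + ε)) := by
    rcases max_choice (incoherence A) (1 / (d : ℝ) ^ K) with e | e <;> rw [e]
    · exact hc
    · exact hdK
  refine ⟨⟨hA, hw, hratio, fun i j hij => (abs_inner_le_incoherence A hij).trans (le_max_left _ _),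
    hγ1, hk, lt_max_of_lt_right (by positivity), ?_⟩, hγβ⟩
  rw [mul_assoc]
  exact (mul_le_mul_of_nonneg_left hγβ (by positivity)).trans hk2

/-- The constant 6 is the 3 extra iterations plus the rounding of `s₁` and, twice, of `s₂`. -/
theorem exists_step_counts {ε Γ γ C Q : ℝ} (hε : 0 < ε) (hΓ : 0 < Γ) (hk : 1 ≤ k) (hd : 1 ≤ d)
    {K : ℕ} (hQ : 2 * (|Real.log Γ| + K + 1) = Q) (hγ : γ ≤ Γ * d)
    (hCstep : 4 * (1 + ε) + 4 * |Real.log (64 * Γ)| + 6 + 4 * Real.log Q ≤ C) :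
    ∃ s₁ s₂ : ℕ, 1 / 2 ≤ 32 * Γ * (k : ℝ) ^ (-(1 + ε)) * (13 / 10) ^ s₁ ∧
      γ * quadRate s₂ ≤ 1 / (d : ℝ) ^ K ∧ ((s₁ + 3 + s₂ + s₂ : ℕ) : ℝ) ≤ C * stepBound k d := by
  have hlogk : 0 ≤ Real.log k := Real.log_nonneg (by exact_mod_cast hk)
  have hlogd : 0 ≤ Real.log d := Real.log_nonneg (by exact_mod_cast hd)
  have hloglogd : 0 ≤ Real.log (1 + Real.log d) := Real.log_nonneg (by linarith)
  have hQ1 : 1 ≤ Q := by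
    have := abs_nonneg (Real.log Γ)
    have : (0 : ℝ) ≤ K := by positivity
    linarith
  have hlogQ : 0 ≤ Real.log Q := Real.log_nonneg hQ1
  have habs := abs_nonneg (Real.log (64 * Γ))
  refine ⟨⌈4 * ((1 + ε) * Real.log k + |Real.log (64 * Γ)|)⌉₊,
    ⌈2 * (Real.log Q + Real.log (1 + Real.log d))⌉₊,
    gap_amplification_steps hΓ hk (Nat.le_ceil _),
    quadratic_convergence_steps hΓ hd hγ hQ.le (Nat.le_ceil _), ?_⟩
  have h1 := (Nat.ceil_lt_add_one
    (by positivity : 0 ≤ 4 * ((1 + ε) * Real.log k + |Real.log (64 * Γ)|))).le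
  have h2 := (Nat.ceil_lt_add_one
    (by positivity : 0 ≤ 2 * (Real.log Q + Real.log (1 + Real.log d)))).le
  have hb : 0 ≤ stepBound k d := by unfold stepBound; linarith
  refine le_trans ?_ (mul_le_mul_of_nonneg_right hCstep hb)
  push_cast
  unfold stepBound
  have h3 : 0 ≤ (4 * |Real.log (64 * Γ)| + 6 + 4 * Real.log Q) *
      (Real.log k + Real.log (1 + Real.log d)) :=
    mul_nonneg (by linarith) (by linarith)
  have h4 : 0 ≤ ε * Real.log (1 + Real.log d) := mul_nonneg hε.le hloglogd
  linarith

/-- The number of times a small-gap region can be stretched. -/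
theorem exists_stretch_count {δ t : ℝ} (hδ0 : 0 < δ) (hδt : 2 * δ ≤ t) :
    ∃ n : ℕ, 1 ≤ n ∧ n * (2 * δ) ≤ t ∧ t ≤ 4 * δ * n := by
  have hx1 : 1 ≤ t / (2 * δ) := by rw [le_div_iff₀ (by positivity)]; linarith
  have hn1 : 1 ≤ ⌊t / (2 * δ)⌋₊ := Nat.le_floor (by exact_mod_cast hx1)
  refine ⟨⌊t / (2 * δ)⌋₊, hn1, ?_, ?_⟩
  · have := Nat.floor_le (by linarith : 0 ≤ t / (2 * δ))
    rwa [le_div_iff₀ (by positivity)] at this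
  · have h1 := Nat.lt_floor_add_one (t / (2 * δ))
    rw [div_lt_iff₀ (by positivity)] at h1
    have h2 : (1 : ℝ) ≤ ⌊t / (2 * δ)⌋₊ := by exact_mod_cast hn1
    nlinarith

/-- The failure probability for large `k`. -/
theorem pi_not_recoversAll_le {ε Γ C Q : ℝ} (hε : 0 < ε) (hΓ : 0 < Γ) (hA : ∀ i, ‖A i‖ = 1)
    (hw : ∀ i, 0 < w i) (hk : 3 ≤ k) {K : ℕ} (hK : 3 + ε ≤ K)
    (hQ : 2 * (|Real.log Γ| + K + 1) = Q)
    (hc : weightRatio w * incoherence A ≤ Γ * (k : ℝ) ^ (-(2 + ε)))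
    (hγ : weightRatio w ≤ Γ * d) (hsmall : Γ * (k : ℝ) ^ (-ε) ≤ 1 / 100000)
    (hsmall' : 128 * Γ * (2 + ε) * (k : ℝ) ^ (-ε) ≤ 1) (hC : 162 ≤ C)
    (hCstep : 4 * (1 + ε) + 4 * |Real.log (64 * Γ)| + 6 + 4 * Real.log Q ≤ C)
    {N : ℕ} (hN : C * stepBound k d ≤ N) :
    Measure.pi (fun _ : Fin k => uniformSphere d) {u | ¬ RecoversAll w A C N u}
      ≤ ENNReal.ofReal
        ((256 * Real.exp 4 * Γ * (2 + ε) + 4) * (1 + Real.log k) * (k : ℝ) ^ (-ε)) := by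
  obtain ⟨h, hγβ⟩ := regular_of_incoherence_le hε hΓ hA hw (by omega) hK hc hγ hsmall
  set β := max (incoherence A) (1 / (d : ℝ) ^ K) with hβ
  have hk0 : (0 : ℝ) < k := by exact_mod_cast (by omega : 0 < k)
  have hk3 : (3 : ℝ) ≤ k := by exact_mod_cast hk
  have hd : 1 ≤ d := by
    rcases Nat.eq_zero_or_pos d with rfl | hd
    · have h1 := h.one_le
      rw [Nat.cast_zero, mul_zero] at hγ
      linarith
    · exact hd
  have hd1 : (1 : ℝ) ≤ d := by exact_mod_cast hd
  have hK0 : K ≠ 0 := by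
    rintro rfl
    rw [Nat.cast_zero] at hK
    linarith
  have hβη : β ≤ eta A := by
    refine max_le_max le_rfl (one_div_le_one_div_of_le (by linarith) ?_)
    exact le_self_pow₀ hd1 hK0
  have hlog1 : 1 ≤ Real.log k := by
    rw [Real.le_log_iff_exp_le hk0]
    have := Real.exp_one_lt_d9
    norm_num at this
    linarith
  -- the gap
  obtain ⟨δ, hδdef⟩ : ∃ δ, δ = 32 * Γ * (k : ℝ) ^ (-(1 + ε)) := ⟨_, rfl⟩
  have hδ0 : 0 < δ := by rw [hδdef]; positivity
  have hkpow : (k : ℝ) * (k : ℝ) ^ (-(2 + ε)) = (k : ℝ) ^ (-(1 + ε)) := by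
    rw [← Real.rpow_one_add' hk0.le (by linarith)]
    congr 1; ring
  have hkpow' : (k : ℝ) * (k : ℝ) ^ (-(1 + ε)) = (k : ℝ) ^ (-ε) := by
    rw [← Real.rpow_one_add' hk0.le (by linarith)]
    congr 1; ring
  -- Insertion of `γβ ≤ Γ k^(-(2+ε))` into the required gap gives exactly `δ`; a larger gap would
  -- only be less likely.
  have hδ : 32 * (k * weightRatio w * β) ≤ δ := by
    rw [hδdef, ← hkpow]
    have := mul_le_mul_of_nonneg_left hγβ hk0.le
    linarith
  obtain ⟨s₁, s₂, hs₁, hs₂', hstep⟩ :=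
    exists_step_counts hε hΓ (by omega : 1 ≤ k) hd hQ hγ hCstep
  rw [← hδdef] at hs₁
  have hs₂ : weightRatio w * quadRate s₂ ≤ β := hs₂'.trans (le_max_right _ _)
  have hNs : s₁ + 3 + s₂ + s₂ ≤ N := by exact_mod_cast hstep.trans hN
  -- the cut-off of the correlations
  obtain ⟨L, hL⟩ : ∃ L, L = 2 * (2 + ε) * Real.log k := ⟨_, rfl⟩
  have hL1 : 1 ≤ L := by rw [hL]; nlinarith
  have hL0 : 0 < L := by linarith
  have ht0 : 0 < 1 / L := by positivity
  have ht1 : 1 / L ≤ 1 := by rw [div_le_one hL0]; exact hL1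
  have hδt : 2 * δ ≤ 1 / L := by
    rw [le_div_iff₀ hL0]
    calc 2 * δ * L = 128 * Γ * (2 + ε) * (Real.log k * (k : ℝ) ^ (-(1 + ε))) := by
          rw [hδdef, hL]; ring
      _ ≤ 128 * Γ * (2 + ε) * (k * (k : ℝ) ^ (-(1 + ε))) := by
          gcongr
          exact Real.log_le_self hk0.le
      _ ≤ 1 := by rw [hkpow']; exact hsmall'
  obtain ⟨n, hn1, hnle, hnge⟩ := exists_stretch_count hδ0 hδt
  -- With `ℓ² = L/d` and `t = 1/L` the constraint `t ℓ² d ≤ 1` is an equality.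
  have hsqrt : Real.sqrt (L / d) ^ 2 = L / d := Real.sq_sqrt (by positivity)
  have hd0 : (0 : ℝ) < d := by linarith
  have hprob := pi_exists_not_hasGap_le (ℓ := Real.sqrt (L / d)) h hd hδ hδ0 (by linarith) hs₁ hs₂
    hNs ht0.le ht1 (Real.sqrt_nonneg _)
    (by rw [hsqrt]; apply le_of_eq; field_simp)
    (inv_one_sub_pow_le hδ0 hδt ht1 hnle) hn1
  have hexp : (d : ℝ) * Real.sqrt (L / d) ^ 2 / 2 = L / 2 := by rw [hsqrt]; field_simp
  rw [hexp] at hprob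
  have hsub : {u | ¬ RecoversAll w A C N u}
      ⊆ {u | ∃ m, ¬ HasGap w δ (startCorr w A N u m)} := by
    intro u hu
    by_contra hgap
    refine hu (recoversAll_of_hasGap h hβη hδ hδ0 hs₁ hs₂ hNs hC hstep fun m => ?_)
    by_contra hm
    exact hgap ⟨m, hm⟩
  refine (measure_mono hsub).trans (hprob.trans ?_)
  rw [← ENNReal.ofReal_natCast, ← ENNReal.ofReal_mul hk0.le]
  exact ENNReal.ofReal_le_ofReal (failure_probability_le hε hk hΓ hδdef hL rfl hL0 hnge hn1)

end Recovery

end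

theorem mainTheorem2 (ε Γ : ℝ) (hε : 0 < ε) (hΓ : 0 < Γ) :
    ∃ (C : ℝ) (p : ℕ), 0 < C ∧
      ∀ (d k : ℕ) (A : Fin k → EuclideanSpace ℝ (Fin d)) (w : Fin k → ℝ),
        (∀ i, ‖A i‖ = 1) → (∀ i, 0 < w i) →
        weightRatio w * incoherence A ≤ Γ * (k : ℝ) ^ (-(2 + ε)) →
        weightRatio w ≤ Γ * d →
        ∀ N : ℕ, C * stepBound k d ≤ N →
          Measure.pi (fun _ : Fin k => uniformSphere d) {u | ¬ RecoversAll w A C N u}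
            ≤ ENNReal.ofReal (C * (1 + Real.log k) ^ p * (k : ℝ) ^ (-ε)) := by
  set K := ⌈3 + ε⌉₊
  set Q := 2 * (|Real.log Γ| + K + 1) with hQ
  have hQ1 : 1 ≤ Q := by
    have := abs_nonneg (Real.log Γ)
    have : (0 : ℝ) ≤ K := by positivity
    linarith
  have hlogQ : 0 ≤ Real.log Q := Real.log_nonneg hQ1
  have habs := abs_nonneg (Real.log (64 * Γ))
  -- Below `κ`, `k^(-ε)` meets both smallness conditions and `k > 3`, so that `log k ≥ 1`.
  set κ : ℝ := min (1 / (100000 * Γ)) (min (1 / (128 * Γ * (2 + ε))) ((3 : ℝ) ^ (-ε))) with hκ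
  have hκ0 : 0 < κ := by rw [hκ]; positivity
  have hexp := Real.exp_pos 4
  set C₁ := 4 * (1 + ε) + 4 * |Real.log (64 * Γ)| + 6 + 4 * Real.log Q with hC₁
  set C₂ := 256 * Real.exp 4 * Γ * (2 + ε) + 4 with hC₂
  have hC₁0 : 0 ≤ C₁ := by positivity
  have hC₂0 : 0 ≤ C₂ := by positivity
  have hκi : 0 < 1 / κ := by positivity
  refine ⟨162 + C₁ + C₂ + 1 / κ, 1, by positivity, fun d k A w hA hw hc hγ N hN => ?_⟩
  set C := 162 + C₁ + C₂ + 1 / κ with hC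
  rcases Nat.eq_zero_or_pos k with rfl | hk
  · have : {u | ¬ RecoversAll w A C N u} = ∅ :=
      Set.eq_empty_iff_forall_notMem.2 fun u hu => hu ⟨Equiv.refl _, fun m => m.elim0⟩
    rw [this, measure_empty]
    exact zero_le
  have hk0 : (0 : ℝ) < k := by exact_mod_cast hk
  have hlog : 0 ≤ Real.log k := Real.log_nonneg (by exact_mod_cast hk)
  have hP0 : 0 < (k : ℝ) ^ (-ε) := Real.rpow_pos_of_pos hk0 _
  rw [pow_one]
  -- For small `k` the asserted bound is at least one, thanks to the summand `1/κ` of `C`.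
  by_cases hlarge : κ ≤ (k : ℝ) ^ (-ε)
  · have hd : 1 ≤ d := by
      rcases Nat.eq_zero_or_pos d with rfl | hd
      · have h1 : A ⟨0, hk⟩ = 0 := Subsingleton.elim _ _
        have h2 := hA ⟨0, hk⟩
        rw [h1, norm_zero] at h2
        exact absurd h2 zero_ne_one
      · exact hd
    have := isProbabilityMeasure_uniformSphere hd
    refine prob_le_one.trans ?_
    rw [ENNReal.one_le_ofReal]
    calc (1 : ℝ) = 1 / κ * 1 * κ := by field_simp
      _ ≤ C * (1 + Real.log k) * (k : ℝ) ^ (-ε) := by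
          gcongr
          · rw [hC]; linarith
          · linarith
  · push Not at hlarge
    obtain ⟨h1, h2, h3⟩ : (k : ℝ) ^ (-ε) < 1 / (100000 * Γ) ∧
        (k : ℝ) ^ (-ε) < 1 / (128 * Γ * (2 + ε)) ∧ (k : ℝ) ^ (-ε) < (3 : ℝ) ^ (-ε) := by
      rw [hκ] at hlarge
      exact ⟨(lt_min_iff.1 hlarge).1, lt_min_iff.1 (lt_min_iff.1 hlarge).2⟩
    have hk3 : 3 ≤ k := by
      by_contra hlt
      push Not at hlt
      have : (k : ℝ) ≤ 3 := by exact_mod_cast hlt.le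
      exact absurd h3 (not_lt.2 (Real.rpow_le_rpow_of_nonpos hk0 this (by linarith)))
    rw [lt_div_iff₀ (by positivity)] at h1 h2
    refine (pi_not_recoversAll_le hε hΓ hA hw hk3 (Nat.le_ceil _) hQ.symm hc hγ (by linarith)
      (by linarith) (by rw [hC]; linarith) (by rw [hC, ← hC₁]; linarith) hN).trans
      (ENNReal.ofReal_le_ofReal ?_)
    rw [← hC₂]
    gcongr
    rw [hC]; linarith
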